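/- Let $X$ be a spindle, i.e. a set with an operation $(x,y)\mapsto x^y$ satisfying $(x^y)^z=(x^z)^{(y^z)}$ and $x^x=x$. Let $A=\mathbb Z M(X)$ be the monoid algebra of $M(X)=\langle X : yx^y=xy\rangle$, and let $$B=\mathbb Z\langle x,e_y : x,y\in X\rangle\big/\langle yx^y-xy,\ ye_{x^y}-e_xy\rangle ,$$ graded by $|x|=0$, $|e_x|=1$, with the derivation $d$ of degree $-1$ given by $d(x)=0$, $d(e_x)=1-x$; it is a differential graded $A$-bimodule. Let $B^+$ be its positive degree part, $B^D$ the two-sided ideal generated by all $e_x^2$, $B^Q=B/B^D$, and $B^N$ the left $A$-submodule generated by $1$ and all $(e_{x_1}-e_{x_2})\cdots(e_{x_{n-1}}-e_{x_n})e_{x_n}$, $n\ge 1$; it is a sub-bimodule. Let $B^L=B_1\otimes_A B^D$, with $b\otimes c$ of degree $1+|c|$. Let $s\colon B^+\to B^D$ replace, in every monomial, the first letter $e_y$ by $e_ye_y$. 1. The map $s$ is well defined, injective, $A$-bilinear and of degree $1$. Multiplication $b\otimes c\mapsto bc$ is injective on $B^L$ and identifies it, as a graded $A$-bimodule, with $B^+B^D\subseteq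 B^D$. With this identification, $B^D=B^L\oplus s((B^N)^+)$ as graded $A$-bimodules. Hence, for $n\ge 2$, the formula $(l,[b])\mapsto l+s(b)$, $b\in B^N_{n-1}$, defines an isomorphism of $A$-bimodules $$B^L_n\oplus B^Q_{n-1}\;\simeq\; B^D_n .$$ 2. For an $A$-bimodule $M$ put $\overline M=\mathbb Z\otimes_A M=M/\langle xm-m : x\in X, m\in M\rangle$, and write $\overline B{}^D,\overline B{}^L,\overline B{}^N,\overline B{}^Q$ accordingly, with the differential induced by $d$ on $\overline B$, $\overline B{}^D$ and $\overline B{}^Q=\overline B/\overline B{}^D$. Then $\overline B{}^D$ and $\overline B{}^L$ embed in $\overline B$, the subspaces $\overline B{}^L$ and $s((\overline B{}^N)^+)$ are subcomplexes, and, for $n\ge 2$, $$\overline B{}^L_n\oplus \overline B{}^Q_{n-1}\;\simeq\;\overline B{}^D_n ,\qquad (l,[b])\mapsto l+s(b)\quad (b\in\overline B{}^N_{n-1}),$$ is an isomorphism of differential graded $A$-bimodules, where the shifted complex $\overline B{}^Q_{\bullet-1}$ (in degrees $\bullet\ge 2$) carries the differential $-d$, as usual for a shift by one. 3. Let $C_n=\mathbb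 ZX^n$ be the rack complex, with $$\partial(x_1\cdots x_n)=\sum_{i=1}^n(-1)^{i-1}\bigl(x_1\cdots\widehat{x_i}\cdots x_n-x_1^{x_i}\cdots x_{i-1}^{x_i}x_{i+1}\cdots x_n\bigr),$$ let $C^D_n$ be spanned by the tuples with two equal neighbours, $C^L_n$ by those with two equal neighbours $x_i=x_{i+1}$ for some $i\ge 2$, and $C^Q=C/C^D$. The map $x_1\cdots x_n\mapsto[e_{x_1}\cdots e_{x_n}]$ is an isomorphism of complexes $C\simeq\overline B$; it carries $C^D$ onto $\overline B{}^D$ and $C^L$ onto $\overline B{}^L$, which are thus subcomplexes, and it transports the isomorphism of part 2 to the Litherland–Nelson isomorphism of complexes $C^D_\bullet\simeq C^L_\bullet\oplus C^Q_{\bullet-1}$ for $\bullet\ge 2$ (same sign convention). -/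

import Mathlib

open scoped TensorProduct

/-- A spindle: a self-distributive structure all of whose elements are idempotent.
In terms of `Shelf`, `Shelf.act y x` is the element usually written `x ◁ y` or `x ^ y`. -/
class Spindle (X : Type*) extends Shelf X where
  act_self : ∀ x : X, act x x = x

noncomputable section

namespace ShelfBialg

section Basic

variable (X : Type*) [Shelf X]

variable {X} in
/-- `rop x y` is the right self-distributive operation `x ◁ y = x ^ y`. -/
abbrev rop (x y : X) : X := Shelf.act y x

variable {X} in
lemma rop_rop (x y z : X) : rop (rop x y) z = rop (rop x z) (rop y z) :=
  Shelf.self_distrib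

/-! ### The structure monoid, the structure algebra and the algebra `B` -/

/-- The relations `y x^y = x y`. -/
inductive MRel : FreeMonoid X → FreeMonoid X → Prop
  | rel (x y : X) : MRel (FreeMonoid.of y * FreeMonoid.of (rop x y))
      (FreeMonoid.of x * FreeMonoid.of y)

/-- The structure monoid `M(X)`. -/
abbrev StrMonoid : Type _ := PresentedMonoid (MRel X)

/-- The structure algebra `A(X) = ℤ M(X)`. -/
def StrAlg : Type _ := MonoidAlgebra ℤ (StrMonoid X)

instance : Ring (StrAlg X) := inferInstanceAs (Ring (MonoidAlgebra ℤ (StrMonoid X)))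

/-- The relations `y x^y = x y` and `y e_{x^y} = e_x y`; the generator `x` is the letter `inl x`
and the generator `e_x` is the letter `inr x`. -/
inductive BRel : FreeAlgebra ℤ (X ⊕ X) → FreeAlgebra ℤ (X ⊕ X) → Prop
  | x (x y : X) : BRel
      (FreeAlgebra.ι ℤ (Sum.inl y) * FreeAlgebra.ι ℤ (Sum.inl (rop x y)))
      (FreeAlgebra.ι ℤ (Sum.inl x) * FreeAlgebra.ι ℤ (Sum.inl y))
  | e (x y : X) : BRel
      (FreeAlgebra.ι ℤ (Sum.inl y) * FreeAlgebra.ι ℤ (Sum.inr (rop x y)))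
      (FreeAlgebra.ι ℤ (Sum.inr x) * FreeAlgebra.ι ℤ (Sum.inl y))

/-- The algebra `B(X)`. -/
def B : Type _ := RingQuot (BRel X)

instance : Ring (B X) := inferInstanceAs (Ring (RingQuot (BRel X)))

variable {X}

/-- The image in `B(X)` of a letter. -/
def letter (c : X ⊕ X) : B X := RingQuot.mkRingHom (BRel X) (FreeAlgebra.ι ℤ c)

/-- The generator `x` of `B(X)`. -/
def gx (x : X) : B X := letter (Sum.inl x)

/-- The generator `e_x` of `B(X)`. -/
def ge (x : X) : B X := letter (Sum.inr x)

lemma gx_rel (x y : X) : gx y * gx (rop x y) = gx x * gx y := by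
  have h := RingQuot.mkRingHom_rel (BRel.x x y)
  rw [map_mul, map_mul] at h
  exact h

lemma ge_rel (x y : X) : gx y * ge (rop x y) = ge x * gx y := by
  have h := RingQuot.mkRingHom_rel (BRel.e x y)
  rw [map_mul, map_mul] at h
  exact h

/-- The universal property of `B(X)`. -/
def lift {R : Type*} [Ring R] (f g : X → R) (hf : ∀ x y, f y * f (rop x y) = f x * f y)
    (hg : ∀ x y, f y * g (rop x y) = g x * f y) : B X →+* R :=
  RingQuot.lift (r := BRel X) ⟨(FreeAlgebra.lift ℤ (Sum.elim f g)).toRingHom, by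
    intro a b h
    cases h with
    | x x y => simpa using hf x y
    | e x y => simpa using hg x y⟩

section lift

variable {R : Type*} [Ring R] (f g : X → R) (hf : ∀ x y, f y * f (rop x y) = f x * f y)
    (hg : ∀ x y, f y * g (rop x y) = g x * f y)

@[simp] lemma lift_gx (x : X) : lift f g hf hg (gx x) = f x := by
  refine (RingQuot.lift_mkRingHom_apply _ _ _).trans ?_
  simp

@[simp] lemma lift_ge (x : X) : lift f g hf hg (ge x) = g x := by
  refine (RingQuot.lift_mkRingHom_apply _ _ _).trans ?_
  simp

end lift

/-- The monomial of `B(X)` given by a word in the letters. -/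
def word (w : List (X ⊕ X)) : B X := (w.map letter).prod

/-- The degree of a word: `|x| = 0` and `|e_x| = 1`. -/
def deg (w : List (X ⊕ X)) : ℕ := w.countP Sum.isRight

@[simp] lemma word_nil : word ([] : List (X ⊕ X)) = 1 := rfl

@[simp] lemma word_inl (x : X) (w : List (X ⊕ X)) :
    word (Sum.inl x :: w) = gx x * word w := by simp [word, gx]

@[simp] lemma word_inr (x : X) (w : List (X ⊕ X)) :
    word (Sum.inr x :: w) = ge x * word w := by simp [word, ge]

lemma word_append (v w : List (X ⊕ X)) : word (v ++ w) = word v * word w := by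
  simp [word]

@[simp] lemma deg_nil : deg ([] : List (X ⊕ X)) = 0 := rfl

@[simp] lemma deg_inl (x : X) (w : List (X ⊕ X)) : deg (Sum.inl x :: w) = deg w := by
  simp [deg]

@[simp] lemma deg_inr (x : X) (w : List (X ⊕ X)) : deg (Sum.inr x :: w) = deg w + 1 :=
  List.countP_cons_of_pos rfl

lemma deg_append (v w : List (X ⊕ X)) : deg (v ++ w) = deg v + deg w := by
  simp [deg]

lemma word_span (b : B X) : b ∈ AddSubgroup.closure (Set.range (word (X := X))) := by
  obtain ⟨a, rfl⟩ := RingQuot.mkRingHom_surjective (BRel X) b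
  induction a using FreeAlgebra.induction with
  | grade0 r =>
    have h1 : RingQuot.mkRingHom (BRel X) (algebraMap ℤ _ r) = r • (word [] : B X) := by
      simp only [eq_intCast, map_intCast, word_nil, zsmul_eq_mul, mul_one]
      rfl
    rw [h1]
    exact AddSubgroup.zsmul_mem _ (AddSubgroup.subset_closure (Set.mem_range_self _)) r
  | grade1 c =>
    refine AddSubgroup.subset_closure ⟨[c], ?_⟩
    change ([letter c] : List (B X)).prod = _
    rw [List.prod_singleton]
    rfl
  | mul a b ha hb =>
    rw [map_mul]
    refine AddSubgroup.closure_induction₂ (p := fun u v _ _ =>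
      u * v ∈ AddSubgroup.closure (Set.range (word (X := X)))) ?_ ?_ ?_ ?_ ?_ ?_ ?_ ha hb
    · rintro _ _ ⟨u, rfl⟩ ⟨v, rfl⟩
      exact AddSubgroup.subset_closure ⟨u ++ v, word_append u v⟩
    · intro x _; rw [zero_mul]; exact zero_mem _
    · intro x _; rw [mul_zero]; exact zero_mem _
    · intro x y z _ _ _ h1 h2; rw [add_mul]; exact add_mem h1 h2
    · intro x y z _ _ _ h1 h2; rw [mul_add]; exact add_mem h1 h2
    · intro x y _ _ h1; rw [neg_mul]; exact neg_mem h1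
    · intro x y _ _ h1; rw [mul_neg]; exact neg_mem h1
  | add a b ha hb => rw [map_add]; exact add_mem ha hb

/-! ### `A(X)`-bimodules

An `A(X)`-bimodule is a left module over the enveloping ring `A ⊗ Aᵒᵖ`, where `a ⊗ a'` acts by
`m ↦ a m a'`. -/

variable (X) in
/-- The enveloping ring of `A(X)`. -/
def Env : Type _ := StrAlg X ⊗[ℤ] (StrAlg X)ᵐᵒᵖ

instance : Ring (Env X) := inferInstanceAs (Ring (StrAlg X ⊗[ℤ] (StrAlg X)ᵐᵒᵖ))

/-- The element `a ⊗ c` of the enveloping ring. -/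
def env (a c : StrAlg X) : Env X := a ⊗ₜ[ℤ] MulOpposite.op c

lemma env_one : env (1 : StrAlg X) 1 = 1 := rfl

lemma env_mul (a c a' c' : StrAlg X) : env a c * env a' c' = env (a * a') (c' * c) :=
  Algebra.TensorProduct.tmul_mul_tmul a a' (MulOpposite.op c) (MulOpposite.op c')

lemma env_induction {p : Env X → Prop} (r : Env X) (h0 : p 0) (h : ∀ a c, p (env a c))
    (hadd : ∀ r t, p r → p t → p (r + t)) : p r :=
  TensorProduct.induction_on (motive := p) r h0 (fun a c => h a c.unop) hadd

/-- The left action of `A(X)` on a bimodule. -/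
def lact {M : Type*} [AddCommGroup M] [Module (Env X) M] (a : StrAlg X) (m : M) : M :=
  env a 1 • m

/-- The right action of `A(X)` on a bimodule. -/
def ract {M : Type*} [AddCommGroup M] [Module (Env X) M] (m : M) (a : StrAlg X) : M :=
  env 1 a • m

/-- The generator `x` of `A(X)`. -/
def gA (x : X) : StrAlg X := MonoidAlgebra.of ℤ (StrMonoid X) (PresentedMonoid.of (MRel X) x)

/-- The algebra morphism `A(X) → B(X)`, `x ↦ x`. -/
def incl : StrAlg X →+* B X :=
  (MonoidAlgebra.lift ℤ (B X) (StrMonoid X) (PresentedMonoid.lift (gx (X := X)) (by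
    rintro a b ⟨x, y⟩
    simpa using gx_rel x y))).toRingHom

@[simp] lemma incl_gA (x : X) : incl (gA x) = gx x := by
  refine (MonoidAlgebra.lift_of _ _).trans ?_
  exact PresentedMonoid.lift_of _ _

lemma strAlg_induction {p : StrAlg X → Prop} (a : StrAlg X) (h1 : p 1)
    (hx : ∀ x a, p a → p (gA x * a)) (hadd : ∀ a b, p a → p b → p (a + b))
    (hneg : ∀ a, p a → p (-a)) : p a := by
  have h0 : p 0 := by simpa using hadd _ _ h1 (hneg _ h1)
  have hz : ∀ (r : ℤ) a, p a → p (r • a) := by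
    intro r a ha
    induction r using Int.induction_on with
    | zero => simpa using h0
    | succ n ih => rw [add_smul, one_smul]; exact hadd _ _ ih ha
    | pred n ih => rw [sub_smul, one_smul, sub_eq_add_neg]; exact hadd _ _ ih (hneg _ ha)
  refine MonoidAlgebra.induction_on (motive := p) a ?_ hadd hz
  intro m
  induction m using PresentedMonoid.inductionOn with
  | h w =>
    induction w using FreeMonoid.inductionOn' with
    | one => exact h1
    | of_mul x w ih =>
      have := hx x _ ih
      rw [map_mul, map_mul]
      exact this

/-- The left action of `A(X)` on `B(X)` by multiplication. -/
instance : Module (StrAlg X) (B X) := Module.compHom (B X) (incl (X := X))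

/-- The right action of `A(X)` on `B(X)` by multiplication. -/
instance : Module (StrAlg X)ᵐᵒᵖ (B X) := Module.compHom (B X) (incl (X := X)).op

lemma smul_def (a : StrAlg X) (b : B X) : a • b = incl a * b := rfl

lemma op_smul_def (a : StrAlg X) (b : B X) : MulOpposite.op a • b = b * incl a := rfl

instance : SMulCommClass (StrAlg X) (StrAlg X)ᵐᵒᵖ (B X) where
  smul_comm a c b := by
    obtain ⟨c, rfl⟩ := MulOpposite.op_surjective c
    simp only [smul_def, op_smul_def, mul_assoc]

attribute [local instance] TensorProduct.Algebra.module in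
/-- `B(X)` as an `A(X)`-bimodule. -/
instance : Module (Env X) (B X) :=
  inferInstanceAs (Module (StrAlg X ⊗[ℤ] (StrAlg X)ᵐᵒᵖ) (B X))

lemma env_smul (a c : StrAlg X) (b : B X) : env a c • b = incl a * b * incl c := by
  rw [mul_assoc]
  exact TensorProduct.Algebra.smul_def a (MulOpposite.op c) b

@[simp] lemma lact_B (a : StrAlg X) (b : B X) : lact a b = incl a * b := by
  rw [lact, env_smul, map_one, mul_one]

@[simp] lemma ract_B (b : B X) (a : StrAlg X) : ract b a = b * incl a := by
  rw [ract, env_smul, map_one, one_mul]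

/-- An additive subgroup of `B(X)` stable under left and right multiplication by all `x ∈ X`, as a
sub-`A(X)`-bimodule. -/
def subBimod (S : AddSubgroup (B X)) (hl : ∀ x, ∀ b ∈ S, gx x * b ∈ S)
    (hr : ∀ x, ∀ b ∈ S, b * gx x ∈ S) : Submodule (Env X) (B X) where
  toAddSubmonoid := S.toAddSubmonoid
  smul_mem' := by
    have hL : ∀ a, ∀ b ∈ S, incl a * b ∈ S := by
      intro a b hb
      induction a using strAlg_induction with
      | h1 => simpa using hb
      | hx x a ih => rw [map_mul, incl_gA, mul_assoc]; exact hl x _ ih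
      | hadd a b ha hb => rw [map_add, add_mul]; exact add_mem ha hb
      | hneg a ha => rw [map_neg, neg_mul]; exact neg_mem ha
    have hR : ∀ a, ∀ b ∈ S, b * incl a ∈ S := by
      intro a b hb
      induction a using strAlg_induction generalizing b with
      | h1 => simpa using hb
      | hx x a ih => rw [map_mul, incl_gA, ← mul_assoc]; exact ih _ (hr x _ hb)
      | hadd a c ha hc => rw [map_add, mul_add]; exact add_mem (ha _ hb) (hc _ hb)
      | hneg a ha => rw [map_neg, mul_neg]; exact neg_mem (ha _ hb)
    intro r b hb
    change r • b ∈ S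
    replace hb : b ∈ S := hb
    induction r using env_induction with
    | h0 => rw [zero_smul]; exact zero_mem _
    | h a c => rw [env_smul]; exact hR _ _ (hL _ _ hb)
    | hadd r t h1 h2 => rw [add_smul]; exact add_mem h1 h2

@[simp] lemma mem_subBimod {S : AddSubgroup (B X)} {hl hr} {b : B X} :
    b ∈ subBimod S hl hr ↔ b ∈ S := Iff.rfl

lemma gx_mul_mem (P : Submodule (Env X) (B X)) (x : X) {b : B X} (hb : b ∈ P) :
    gx x * b ∈ P := by
  have := P.smul_mem (env (gA x) 1) hb
  rwa [env_smul, incl_gA, map_one, mul_one] at this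

/-- A closure of a set stable under an additive map is stable under it. -/
lemma closure_stable {S : Set (B X)} (f : B X →+ B X)
    (h : ∀ b ∈ S, f b ∈ AddSubgroup.closure S) :
    ∀ b ∈ AddSubgroup.closure S, f b ∈ AddSubgroup.closure S := by
  intro b hb
  have : AddSubgroup.closure S ≤ (AddSubgroup.closure S).comap f :=
    (AddSubgroup.closure_le _).2 h
  exact this hb

/-! ### Grading, degenerate part, complement -/

variable (X) in
/-- The degree `n` part `B_n`: the span of the monomials of degree `n`. -/
def gr (n : ℕ) : Submodule (Env X) (B X) :=
  subBimod (AddSubgroup.closure {b | ∃ w, deg w = n ∧ b = word w})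
    (fun x => closure_stable (AddMonoidHom.mulLeft (gx x)) (by
      rintro _ ⟨w, hw, rfl⟩
      exact AddSubgroup.subset_closure ⟨Sum.inl x :: w, by simpa using hw, by simp⟩))
    (fun x => closure_stable (AddMonoidHom.mulRight (gx x)) (by
      rintro _ ⟨w, hw, rfl⟩
      exact AddSubgroup.subset_closure ⟨w ++ [Sum.inl x], by simpa [deg_append] using hw,
        by simp [word_append]⟩))

variable (X) in
/-- The positive degree part `B⁺`. -/
def pos : Submodule (Env X) (B X) := ⨆ n : ℕ, gr X (n + 1)

variable (X) in
/-- The degenerate part `B^D`: the two-sided ideal generated by the `e_x²`. -/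
def degen : Submodule (Env X) (B X) :=
  subBimod (AddSubgroup.closure {b | ∃ u x v, b = u * (ge x * ge x) * v})
    (fun x => closure_stable (AddMonoidHom.mulLeft (gx x)) (by
      rintro _ ⟨u, y, v, rfl⟩
      exact AddSubgroup.subset_closure ⟨gx x * u, y, v, by simp [mul_assoc]⟩))
    (fun x => closure_stable (AddMonoidHom.mulRight (gx x)) (by
      rintro _ ⟨u, y, v, rfl⟩
      exact AddSubgroup.subset_closure ⟨u, y, v * gx x, by simp [mul_assoc]⟩))

/-- `(e_{x₁} - e_{x₂}) ⋯ (e_{xₙ₋₁} - e_{xₙ}) e_{xₙ}`, and `1` for the empty list. -/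
def diffWord : List X → B X
  | [] => 1
  | [x] => ge x
  | x :: y :: l => (ge x - ge y) * diffWord (y :: l)

lemma diffWord_mul_gx (y : X) : ∀ l : List X,
    diffWord l * gx y = gx y * diffWord (l.map fun x => rop x y)
  | [] => by simp [diffWord]
  | [x] => by simpa [diffWord] using (ge_rel x y).symm
  | x :: z :: l => by
    have ih := diffWord_mul_gx y (z :: l)
    simp only [List.map_cons] at ih
    simp only [diffWord, List.map_cons]
    rw [mul_assoc, ih, ← mul_assoc, sub_mul, ← ge_rel, ← ge_rel, ← mul_sub, mul_assoc]

variable (X) in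
/-- The complement `B^N`: the left sub-`A(X)`-module generated by the elements `diffWord l`; it
is stable under the right action. -/
def BN : Submodule (Env X) (B X) :=
  subBimod (AddSubgroup.closure {b | ∃ a l, b = incl a * diffWord l})
    (fun x => closure_stable (AddMonoidHom.mulLeft (gx x)) (by
      rintro _ ⟨a, l, rfl⟩
      exact AddSubgroup.subset_closure ⟨gA x * a, l, by simp [mul_assoc]⟩))
    (fun x => closure_stable (AddMonoidHom.mulRight (gx x)) (by
      rintro _ ⟨a, l, rfl⟩
      refine AddSubgroup.subset_closure ⟨a * gA x, l.map fun z => rop z x, ?_⟩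
      simp [mul_assoc, diffWord_mul_gx]))

variable (X) in
/-- `B^D_n`. -/
abbrev DGr (n : ℕ) : Submodule (Env X) (B X) := degen X ⊓ gr X n

variable (X) in
/-- `B^N_n`. -/
abbrev NGr (n : ℕ) : Submodule (Env X) (B X) := BN X ⊓ gr X n

variable (X) in
/-- `B^Q_n = B_n / B^D_n`, where `B^Q = B / B^D`. -/
abbrev QGr (n : ℕ) : Type _ := gr X n ⧸ (DGr X n).submoduleOf (gr X n)

/-! ### The differential and the degeneracy

Both are upper right corners of a morphism from `B(X)` to upper triangular matrices, sending `x` to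
the diagonal matrix with entries `x, x`, and `e_x` to the matrix with rows `(p x, q x)` and
`(0, e_x)`. -/

section corner

variable (p q : X → B X) (hp : ∀ x y, gx y * p (rop x y) = p x * gx y)
  (hq : ∀ x y, gx y * q (rop x y) = q x * gx y)

/-- The morphism to triangular matrices. -/
def triHom : B X →+* Matrix (Fin 2) (Fin 2) (B X) :=
  lift (fun x => !![gx x, 0; 0, gx x]) (fun x => !![p x, q x; 0, ge x])
    (fun x y => by simp [gx_rel])
    (fun x y => by simp [ge_rel, hp, hq])

lemma triHom_incl (a : StrAlg X) : triHom p q hp hq (incl a) = !![incl a, 0; 0, incl a] := by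
  induction a using strAlg_induction with
  | h1 => simp [Matrix.one_fin_two]
  | hx x a ih =>
    have hx : triHom p q hp hq (gx x) = !![gx x, 0; 0, gx x] := by simp [triHom]
    rw [map_mul, map_mul, ih, incl_gA, hx, Matrix.mul_fin_two]
    simp
  | hadd a b ha hb => simp [ha, hb]
  | hneg a ha => simp [ha]

lemma triHom_gx_mul (x : X) (b : B X) (i j : Fin 2) :
    triHom p q hp hq (gx x * b) i j = gx x * triHom p q hp hq b i j := by
  rw [map_mul, Matrix.mul_apply]
  fin_cases i <;> simp [triHom]

lemma triHom_ge_mul_zero (x : X) (b : B X) (j : Fin 2) :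
    triHom p q hp hq (ge x * b) 0 j =
      p x * triHom p q hp hq b 0 j + q x * triHom p q hp hq b 1 j := by
  rw [map_mul, Matrix.mul_apply]
  simp [triHom]

lemma triHom_ge_mul_one (x : X) (b : B X) (j : Fin 2) :
    triHom p q hp hq (ge x * b) 1 j = ge x * triHom p q hp hq b 1 j := by
  rw [map_mul, Matrix.mul_apply]
  simp [triHom]

lemma triHom_one_one (b : B X) : triHom p q hp hq b 1 1 = b := by
  refine AddSubgroup.closure_induction (p := fun b _ => triHom p q hp hq b 1 1 = b)
    ?_ (by simp) (fun x y _ _ h1 h2 => by simp [h1, h2]) (fun x _ h => by simp [h]) (word_span b)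
  rintro _ ⟨w, rfl⟩
  induction w with
  | nil => simp
  | cons c w ih =>
    cases c with
    | inl x => simp [triHom_gx_mul, ih]
    | inr x => simp [triHom_ge_mul_one, ih]

/-- The upper right corner, as a morphism of bimodules. -/
def corner : B X →ₗ[Env X] B X where
  toFun b := triHom p q hp hq b 0 1
  map_add' a b := by simp
  map_smul' r b := by
    change triHom p q hp hq (r • b) 0 1 = r • triHom p q hp hq b 0 1
    induction r using env_induction with
    | h0 => simp only [zero_smul, map_zero, Matrix.zero_apply]
    | h a c =>
      simp only [env_smul, map_mul, triHom_incl]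
      simp only [Matrix.mul_apply, Fin.sum_univ_two]
      simp
    | hadd r t hr ht =>
      simp only [add_smul, map_add, Matrix.add_apply, hr, ht]

lemma corner_one : corner p q hp hq 1 = 0 := by simp [corner]

lemma corner_gx_mul (x : X) (b : B X) :
    corner p q hp hq (gx x * b) = gx x * corner p q hp hq b := triHom_gx_mul ..

lemma corner_ge_mul (x : X) (b : B X) :
    corner p q hp hq (ge x * b) = p x * corner p q hp hq b + q x * b := by
  refine (triHom_ge_mul_zero ..).trans ?_
  rw [triHom_one_one]
  rfl

end corner

variable (X) in
/-- The differential of `B(X)`: the derivation with `d x = 0` and `d e_x = 1 - x`. -/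
def d : B X →ₗ[Env X] B X :=
  corner (fun x => -ge x) (fun x => 1 - gx x)
    (fun x y => by simp [ge_rel])
    (fun x y => by rw [mul_sub, sub_mul, gx_rel, mul_one, one_mul])

variable (X) in
/-- The degeneracy: in a monomial, the first letter `e_y` is replaced by `e_y e_y`. It is
extended by `0` to degree `0`. -/
def s : B X →ₗ[Env X] B X :=
  corner (fun _ => 0) (fun x => ge x * ge x)
    (fun x y => by simp)
    (fun x y => by rw [← mul_assoc, ge_rel, mul_assoc, ge_rel, mul_assoc])

@[simp] lemma d_one : d X 1 = 0 := corner_one ..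

@[simp] lemma d_gx_mul (x : X) (b : B X) : d X (gx x * b) = gx x * d X b := corner_gx_mul ..

@[simp] lemma d_ge_mul (x : X) (b : B X) :
    d X (ge x * b) = (1 - gx x) * b - ge x * d X b := by
  refine (corner_ge_mul ..).trans ?_
  change -ge x * d X b + _ = _
  rw [neg_mul, neg_add_eq_sub]

lemma d_gx (x : X) : d X (gx x) = 0 := by simpa using d_gx_mul x 1

lemma d_ge (x : X) : d X (ge x) = 1 - gx x := by simpa using d_ge_mul x 1

@[simp] lemma s_one : s X 1 = 0 := corner_one ..

@[simp] lemma s_gx_mul (x : X) (b : B X) : s X (gx x * b) = gx x * s X b := corner_gx_mul ..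

@[simp] lemma s_ge_mul (x : X) (b : B X) : s X (ge x * b) = ge x * ge x * b := by
  refine (corner_ge_mul ..).trans ?_
  rw [zero_mul, zero_add]

lemma d_word_mul (w : List (X ⊕ X)) (b : B X) :
    d X (word w * b) = d X (word w) * b + (-1) ^ deg w * word w * d X b := by
  induction w with
  | nil => simp
  | cons c w ih =>
    cases c with
    | inl x =>
      have h : gx x * (-1) ^ deg w = (-1) ^ deg w * gx x :=
        ((Commute.neg_one_right (gx x)).pow_right _).eq
      simp only [word_inl, mul_assoc, d_gx_mul, deg_inl, ih, mul_add]
      rw [← mul_assoc (gx x) ((-1) ^ deg w), h, mul_assoc]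
    | inr x =>
      have h : ge x * (-1) ^ deg w = (-1) ^ deg w * ge x :=
        ((Commute.neg_one_right (ge x)).pow_right _).eq
      simp only [word_inr, mul_assoc, d_ge_mul, deg_inr, ih, mul_add, sub_mul, one_mul, pow_succ,
        neg_mul, mul_neg]
      rw [← mul_assoc (ge x) ((-1) ^ deg w), h, mul_assoc]
      abel

/-- The graded Leibniz rule. -/
lemma d_mul {n : ℕ} {a : B X} (ha : a ∈ gr X n) (b : B X) :
    d X (a * b) = d X a * b + (-1) ^ n * a * d X b := by
  refine AddSubgroup.closure_induction (p := fun a _ =>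
    d X (a * b) = d X a * b + (-1) ^ n * a * d X b) ?_ (by simp) ?_ ?_ ha
  · rintro _ ⟨w, rfl, rfl⟩
    exact d_word_mul w b
  · intro x y _ _ h1 h2
    rw [add_mul, map_add, map_add, h1, h2]
    noncomm_ring
  · intro x _ h
    rw [neg_mul, map_neg, map_neg, h]
    noncomm_ring

lemma d_d (b : B X) : d X (d X b) = 0 := by
  refine AddSubgroup.closure_induction (p := fun b _ => d X (d X b) = 0)
    ?_ (by simp) (fun x y _ _ h1 h2 => by simp [h1, h2]) (fun x _ h => by simp [h]) (word_span b)
  rintro _ ⟨w, rfl⟩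
  induction w with
  | nil => simp
  | cons c w ih =>
    cases c with
    | inl x => simp [ih]
    | inr x => simp [ih, sub_mul]

lemma word_mem_gr (w : List (X ⊕ X)) : word w ∈ gr X (deg w) :=
  AddSubgroup.subset_closure ⟨w, rfl, rfl⟩

lemma ge_mul_mem_gr (x : X) {n : ℕ} {b : B X} (hb : b ∈ gr X n) : ge x * b ∈ gr X (n + 1) := by
  have : (AddSubgroup.closure {b | ∃ w, deg w = n ∧ b = word w} : AddSubgroup (B X)) ≤
      (gr X (n + 1)).toAddSubgroup.comap (AddMonoidHom.mulLeft (ge x)) := by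
    refine (AddSubgroup.closure_le _).2 ?_
    rintro _ ⟨w, rfl, rfl⟩
    have := word_mem_gr (Sum.inr x :: w)
    rwa [deg_inr, word_inr] at this
  exact this hb

lemma d_word_mem (w : List (X ⊕ X)) :
    (deg w = 0 → d X (word w) = 0) ∧ ∀ n, deg w = n + 1 → d X (word w) ∈ gr X n := by
  induction w with
  | nil => simp
  | cons c w ih =>
    cases c with
    | inl x =>
      refine ⟨fun h => ?_, fun n h => ?_⟩
      · rw [word_inl, d_gx_mul, ih.1 (by simpa using h), mul_zero]
      · rw [word_inl, d_gx_mul]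
        exact gx_mul_mem _ _ (ih.2 n (by simpa using h))
    | inr x =>
      refine ⟨fun h => by simp at h, fun n h => ?_⟩
      obtain rfl : deg w = n := by simpa using h
      rw [word_inr, d_ge_mul, sub_mul, one_mul]
      refine sub_mem (sub_mem (word_mem_gr w) (gx_mul_mem _ _ (word_mem_gr w))) ?_
      rcases hn : deg w with _ | m
      · rw [ih.1 hn, mul_zero]; exact zero_mem _
      · exact ge_mul_mem_gr x (ih.2 m hn)

/-- The differential lowers the degree by one. -/
lemma d_mem_gr {n : ℕ} {b : B X} (hb : b ∈ gr X (n + 1)) : d X b ∈ gr X n := by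
  have : (AddSubgroup.closure {b | ∃ w, deg w = n + 1 ∧ b = word w} : AddSubgroup (B X)) ≤
      (gr X n).toAddSubgroup.comap (d X).toAddMonoidHom := by
    refine (AddSubgroup.closure_le _).2 ?_
    rintro _ ⟨w, hw, rfl⟩
    exact (d_word_mem w).2 n hw
  exact this hb

/-! ### The tensor product over `A(X)` and the late degenerate part -/

section tensor

variable (M N : Type*) [AddCommGroup M] [AddCommGroup N] [Module (Env X) M] [Module (Env X) N]

variable (X) in
/-- The relations `m a ⊗ n = m ⊗ a n`. -/
def balanced : AddSubgroup (M ⊗[ℤ] N) :=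
  AddSubgroup.closure {t | ∃ (m : M) (a : StrAlg X) (n : N),
    t = ract m a ⊗ₜ[ℤ] n - m ⊗ₜ[ℤ] lact a n}

variable (X) in
/-- The tensor product `M ⊗_A N` of two `A(X)`-bimodules. -/
def TensorA : Type _ := (M ⊗[ℤ] N) ⧸ balanced X M N

instance : AddCommGroup (TensorA X M N) :=
  inferInstanceAs (AddCommGroup ((M ⊗[ℤ] N) ⧸ balanced X M N))

variable {M N}

/-- The class of `m ⊗ n` in `M ⊗_A N`. -/
def tmulA (m : M) (n : N) : TensorA X M N := QuotientAddGroup.mk' (balanced X M N) (m ⊗ₜ[ℤ] n)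

/-- Biadditive maps `f` with `f (m a) n = f m (a n)` induce maps on `M ⊗_A N`. -/
def TensorA.lift {P : Type*} [AddCommGroup P] (f : M →+ N →+ P)
    (hf : ∀ m (a : StrAlg X) n, f (ract m a) n = f m (lact a n)) : TensorA X M N →+ P :=
  QuotientAddGroup.lift (balanced X M N)
    (TensorProduct.liftAddHom f (fun r m n => by simp)) (by
      refine (AddSubgroup.closure_le _).2 ?_
      rintro _ ⟨m, a, n, rfl⟩
      simp [hf])

@[simp] lemma TensorA.lift_tmulA {P : Type*} [AddCommGroup P] (f : M →+ N →+ P)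
    (hf : ∀ m (a : StrAlg X) n, f (ract m a) n = f m (lact a n)) (m : M) (n : N) :
    TensorA.lift f hf (tmulA m n) = f m n := rfl

lemma TensorA.hom_ext {P : Type*} [AddCommGroup P] {f g : TensorA X M N →+ P}
    (h : ∀ m n, f (tmulA m n) = g (tmulA m n)) : f = g := by
  refine QuotientAddGroup.addMonoidHom_ext _ ?_
  ext t
  induction t using TensorProduct.induction_on with
  | zero => simp
  | tmul m n => exact h m n
  | add t u ht hu => rw [map_add, map_add, ht, hu]

lemma tmulA_add_left (m m' : M) (n : N) :
    tmulA (X := X) (m + m') n = tmulA m n + tmulA m' n := by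
  simp only [tmulA, TensorProduct.add_tmul, map_add]
  rfl

lemma tmulA_add_right (m : M) (n n' : N) :
    tmulA (X := X) m (n + n') = tmulA m n + tmulA m n' := by
  simp only [tmulA, TensorProduct.tmul_add, map_add]
  rfl

lemma tmulA_ract (m : M) (a : StrAlg X) (n : N) :
    tmulA (X := X) (ract m a) n = tmulA m (lact a n) := by
  refine sub_eq_zero.1 ?_
  refine (map_sub (QuotientAddGroup.mk' (balanced X M N)) _ _).symm.trans ?_
  exact (QuotientAddGroup.eq_zero_iff _).2 (AddSubgroup.subset_closure ⟨m, a, n, rfl⟩)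

lemma lact_ract (a c : StrAlg X) (m : M) : lact a (ract m c) = ract (lact a m) c := by
  simp only [lact, ract, smul_smul, env_mul, one_mul, mul_one]

lemma lact_mul (a c : StrAlg X) (m : M) : lact (a * c) m = lact a (lact c m) := by
  simp only [lact, smul_smul, env_mul, mul_one]

lemma ract_mul (a c : StrAlg X) (m : M) : ract m (a * c) = ract (ract m a) c := by
  simp only [ract, smul_smul, env_mul, mul_one]

lemma lact_one (m : M) : lact (1 : StrAlg X) m = m := by rw [lact, env_one, one_smul]

lemma ract_one (m : M) : ract m (1 : StrAlg X) = m := by rw [ract, env_one, one_smul]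

lemma lact_add (a : StrAlg X) (m m' : M) : lact a (m + m') = lact a m + lact a m' := smul_add ..

lemma ract_add (a : StrAlg X) (m m' : M) : ract (m + m') a = ract m a + ract m' a := smul_add ..

lemma env_eq (a c : StrAlg X) : env a c = env a 1 * env 1 c := by
  rw [env_mul, mul_one, mul_one]

lemma env_add_left (a a' c : StrAlg X) : env (a + a') c = env a c + env a' c :=
  TensorProduct.add_tmul ..

lemma env_add_right (a c c' : StrAlg X) : env a (c + c') = env a c + env a c' :=
  TensorProduct.tmul_add ..

lemma add_lact (a a' : StrAlg X) (m : M) : lact (a + a') m = lact a m + lact a' m := by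
  simp only [lact, env_add_left, add_smul]

lemma ract_addR (a a' : StrAlg X) (m : M) : ract m (a + a') = ract m a + ract m a' := by
  simp only [ract, env_add_right, add_smul]

/-- The endomorphism `m ⊗ n ↦ a m ⊗ n c` of `M ⊗_A N`. -/
def tact (a c : StrAlg X) : TensorA X M N →+ TensorA X M N :=
  TensorA.lift
    (AddMonoidHom.mk' (fun m => AddMonoidHom.mk' (fun n => tmulA (lact a m) (ract n c))
        (fun n n' => by rw [ract_add, tmulA_add_right]))
      (fun m m' => by ext n; simp [lact_add, tmulA_add_left]))
    (fun m a' n => by simp [lact_ract, tmulA_ract])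

@[simp] lemma tact_tmulA (a c : StrAlg X) (m : M) (n : N) :
    tact a c (tmulA m n) = tmulA (X := X) (lact a m) (ract n c) := rfl

lemma tact_mul (a c a' c' : StrAlg X) :
    (tact (a * a') (c' * c) : TensorA X M N →+ TensorA X M N) = (tact a c).comp (tact a' c') :=
  TensorA.hom_ext fun m n => by simp [lact_mul, ract_mul]

lemma tact_one : (tact 1 1 : TensorA X M N →+ TensorA X M N) = AddMonoidHom.id _ :=
  TensorA.hom_ext fun m n => by simp [lact_one, ract_one]

lemma tact_add_left (a a' c : StrAlg X) :
    (tact (a + a') c : TensorA X M N →+ TensorA X M N) = tact a c + tact a' c :=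
  TensorA.hom_ext fun m n => by simp [add_lact, tmulA_add_left]

lemma tact_add_right (a c c' : StrAlg X) :
    (tact a (c + c') : TensorA X M N →+ TensorA X M N) = tact a c + tact a c' :=
  TensorA.hom_ext fun m n => by simp [ract_addR, tmulA_add_right]

/-- The left action on `M ⊗_A N`. -/
def tactL : StrAlg X →+* AddMonoid.End (TensorA X M N) :=
  RingHom.mk' ⟨⟨fun a => tact a 1, tact_one⟩, fun a b => by
      have h := tact_mul (M := M) (N := N) a 1 b 1
      rw [mul_one] at h
      exact h⟩
    (fun a b => tact_add_left a b 1)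

/-- The right action on `M ⊗_A N`. -/
def tactR : (StrAlg X)ᵐᵒᵖ →+* AddMonoid.End (TensorA X M N) :=
  RingHom.mk' ⟨⟨fun a => tact 1 a.unop, tact_one⟩, fun a b => by
      have h := tact_mul (M := M) (N := N) 1 a.unop 1 b.unop
      rw [mul_one] at h
      exact h⟩
    (fun a b => tact_add_right 1 a.unop b.unop)

/-- The enveloping ring acting on `M ⊗_A N`. -/
def tactHom : Env X →+* AddMonoid.End (TensorA X M N) :=
  (Algebra.TensorProduct.lift (R := ℤ) (S := ℤ) (A := StrAlg X) (B := (StrAlg X)ᵐᵒᵖ)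
    (C := AddMonoid.End (TensorA X M N)) (RingHom.toIntAlgHom tactL) (RingHom.toIntAlgHom tactR)
    (fun a b => by
      have h1 := tact_mul (M := M) (N := N) a 1 1 b.unop
      have h2 := tact_mul (M := M) (N := N) 1 b.unop a 1
      simp only [mul_one, one_mul] at h1 h2
      exact h1.symm.trans h2)).toRingHom

/-- `M ⊗_A N` as an `A(X)`-bimodule: `a (m ⊗ n) c = a m ⊗ n c`. -/
instance : Module (Env X) (TensorA X M N) := Module.compHom (TensorA X M N) (tactHom (X := X) (M := M) (N := N))

lemma env_smul_tmulA (a c : StrAlg X) (m : M) (n : N) :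
    env a c • tmulA (X := X) m n = tmulA (lact a m) (ract n c) := by
  have h1 := tact_mul (M := M) (N := N) a 1 1 c
  simp only [mul_one] at h1
  have h : tactHom (M := M) (N := N) (env a c) = tact a c :=
    (Algebra.TensorProduct.lift_tmul ..).trans h1.symm
  change tactHom (M := M) (N := N) (env a c) (tmulA m n) = _
  rw [h]
  exact tact_tmulA ..

end tensor

variable (X) in
/-- The late degenerate part `B^L = B_1 ⊗_A B^D`. -/
abbrev BL : Type _ := TensorA X (gr X 1) (degen X)

variable (X) in
/-- `B^L_n`, spanned by the `b ⊗ c` with `b` of degree `1` and `c` of degree `n - 1`. -/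
def LGr (n : ℕ) : Submodule (Env X) (BL X) :=
  Submodule.span (Env X) {t | ∃ (b : gr X 1) (c : degen X) (m : ℕ),
    m + 1 = n ∧ (c : B X) ∈ gr X m ∧ t = tmulA b c}

lemma coe_lact (P : Submodule (Env X) (B X)) (a : StrAlg X) (b : P) :
    ((lact a b : P) : B X) = incl a * b :=
  lact_B a (b : B X)

lemma coe_ract (P : Submodule (Env X) (B X)) (a : StrAlg X) (b : P) :
    ((ract b a : P) : B X) = b * incl a :=
  ract_B (b : B X) a

variable (X) in
/-- The additive map underlying `mulMap`. -/
def mulAdd : BL X →+ B X :=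
  TensorA.lift
    (AddMonoidHom.mk' (fun b : gr X 1 => AddMonoidHom.mk' (fun c : degen X => (b * c : B X))
        (fun c c' => by simp [mul_add]))
      (fun b b' => by ext c; simp [add_mul]))
    (fun b a c => by simp [coe_lact, coe_ract, mul_assoc])

lemma mulAdd_tmulA (b : gr X 1) (c : degen X) : mulAdd X (tmulA b c) = (b * c : B X) := rfl

variable (X) in
/-- The multiplication map `B^L → B`, `b ⊗ c ↦ b c`. -/
def mulMap : BL X →ₗ[Env X] B X where
  toFun := mulAdd X
  map_add' t u := map_add _ t u
  map_smul' r t := by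
    change mulAdd X (r • t) = r • mulAdd X t
    induction r using env_induction with
    | h0 => simp only [zero_smul, map_zero]
    | h a c =>
      have h : (mulAdd X).comp (DistribSMul.toAddMonoidHom _ (env a c)) =
          (DistribSMul.toAddMonoidHom _ (env a c)).comp (mulAdd X) :=
        TensorA.hom_ext fun m n => by
          simp [env_smul_tmulA, env_smul, mulAdd_tmulA, coe_lact, coe_ract, mul_assoc]
      exact DFunLike.congr_fun h t
    | hadd r r' h h' => rw [add_smul, map_add, h, h', add_smul]

@[simp] lemma mulMap_tmulA (b : gr X 1) (c : degen X) :
    mulMap X (tmulA b c) = (b * c : B X) := rfl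

/-! ### The quotient by the left augmentation -/

section bar

variable (M N : Type*) [AddCommGroup M] [AddCommGroup N] [Module (Env X) M] [Module (Env X) N]

variable (X) in
/-- The span of the elements `x m - m`. -/
def barSub : Submodule (Env X) M :=
  Submodule.span (Env X) {t | ∃ (x : X) (m : M), t = lact (gA x) m - m}

variable (X) in
/-- `M̄ = ℤ ⊗_A M = M / ⟨x m - m⟩`. -/
abbrev Bar : Type _ := M ⧸ barSub X M

variable {M N}

lemma barSub_le (f : M →ₗ[Env X] N) : barSub X M ≤ (barSub X N).comap f := by
  refine Submodule.span_le.2 ?_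
  rintro _ ⟨x, m, rfl⟩
  refine Submodule.subset_span ⟨x, f m, ?_⟩
  simp [lact]

/-- The map `M̄ → N̄` induced by a morphism of bimodules. -/
def barMap (f : M →ₗ[Env X] N) : Bar X M →ₗ[Env X] Bar X N :=
  Submodule.mapQ _ _ f (barSub_le f)

end bar

variable (X) in
/-- The complex `B̄`, a quotient of `B`. -/
abbrev BBar : Type _ := Bar X (B X)

variable (X) in
/-- The projection `B → B̄`. -/
abbrev pr : B X →ₗ[Env X] BBar X := (barSub X (B X)).mkQ

variable (X) in
/-- The differential of `B̄`. -/
abbrev dBar : BBar X →ₗ[Env X] BBar X := barMap (d X)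

variable (X) in
/-- The degeneracy of `B̄`. -/
abbrev sBar : BBar X →ₗ[Env X] BBar X := barMap (s X)

variable (X) in
/-- `B̄_n`. -/
def grBar (n : ℕ) : Submodule (Env X) (BBar X) := (gr X n).map (pr X)

variable (X) in
/-- `B̄^D_n`. -/
def DBar (n : ℕ) : Submodule (Env X) (BBar X) := (DGr X n).map (pr X)

variable (X) in
/-- `B̄^N_n`. -/
def NBar (n : ℕ) : Submodule (Env X) (BBar X) := (NGr X n).map (pr X)

variable (X) in
/-- `B̄^L_n`, as a submodule of `B̄`. -/
def LBar (n : ℕ) : Submodule (Env X) (BBar X) := ((LGr X n).map (mulMap X)).map (pr X)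

variable (X) in
/-- `B̄^Q_n = B̄_n / B̄^D_n`. -/
abbrev QBar (n : ℕ) : Type _ := grBar X n ⧸ (DBar X n).submoduleOf (grBar X n)

lemma dBar_grBar (n : ℕ) : ∀ b ∈ grBar X (n + 1), dBar X b ∈ grBar X n := by
  rintro _ ⟨b, hb, rfl⟩
  exact ⟨d X b, d_mem_gr hb, rfl⟩

variable (X) in
/-- The differential `B̄_{n+1} → B̄_n`. -/
def dGrBar (n : ℕ) : grBar X (n + 1) →ₗ[Env X] grBar X n :=
  (dBar X).restrict (dBar_grBar n)

/-! ### The rack complex -/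

variable (X) in
/-- `C_n(X)`, the free abelian group on `X^n`. -/
abbrev RC (n : ℕ) : Type _ := (Fin n → X) →₀ ℤ

/-- The tuple with `x_i` omitted. -/
def face0 {n : ℕ} (x : Fin (n + 1) → X) (i : Fin (n + 1)) : Fin n → X :=
  fun j => x (i.succAbove j)

/-- The tuple with `x_i` omitted and the entries before it acted on by `x_i`. -/
def face1 {n : ℕ} (x : Fin (n + 1) → X) (i : Fin (n + 1)) : Fin n → X :=
  fun j => if j.castSucc < i then rop (x (i.succAbove j)) (x i) else x (i.succAbove j)

variable (X) in
/-- The rack differential. -/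
def bdry (n : ℕ) : RC X (n + 1) →ₗ[ℤ] RC X n :=
  Finsupp.linearCombination ℤ fun x => ∑ i : Fin (n + 1), (-1 : ℤ) ^ (i : ℕ) •
    (Finsupp.single (face0 x i) (1 : ℤ) - Finsupp.single (face1 x i) 1)

variable (X) in
/-- `C^D_n`, spanned by the tuples with equal neighbours. -/
def CD (n : ℕ) : Submodule ℤ (RC X n) :=
  Submodule.span ℤ {c | ∃ x : Fin n → X,
    (∃ i j : Fin n, (i : ℕ) + 1 = j ∧ x i = x j) ∧ c = Finsupp.single x 1}

variable (X) in
/-- `C^L_n`, spanned by the tuples with equal neighbours elsewhere than at the beginning. -/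
def CL (n : ℕ) : Submodule ℤ (RC X n) :=
  Submodule.span ℤ {c | ∃ x : Fin n → X,
    (∃ i j : Fin n, 0 < (i : ℕ) ∧ (i : ℕ) + 1 = j ∧ x i = x j) ∧ c = Finsupp.single x 1}

variable (X) in
/-- `C^Q_n = C_n / C^D_n`. -/
abbrev CQ (n : ℕ) : Type _ := RC X n ⧸ CD X n

/-- The monomial `e_{x_1} ⋯ e_{x_n}`. -/
def eMono {n : ℕ} (x : Fin n → X) : B X := (List.ofFn fun i => ge (x i)).prod

end Basic

/-! ### The differential preserves the degenerate part -/

section Spindle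

variable {X : Type*} [Spindle X]

lemma d_ge_sq (x : X) (b : B X) : d X (ge x * (ge x * b)) = ge x * (ge x * d X b) := by
  have h : gx x * ge x = ge x * gx x := by
    have := ge_rel x x
    rwa [show rop x x = x from Spindle.act_self x] at this
  rw [d_ge_mul, d_ge_mul]
  simp only [sub_mul, mul_sub, one_mul, ← mul_assoc, h]
  abel

lemma ge_sq_mem (u v : B X) (x : X) : u * (ge x * ge x) * v ∈ degen X :=
  AddSubgroup.subset_closure ⟨u, x, v, rfl⟩

lemma ge_mul_mem_degen (x : X) {b : B X} (hb : b ∈ degen X) : ge x * b ∈ degen X := by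
  refine closure_stable (AddMonoidHom.mulLeft (ge x)) ?_ b hb
  rintro _ ⟨u, y, v, rfl⟩
  exact AddSubgroup.subset_closure ⟨ge x * u, y, v, by simp [mul_assoc]⟩

/-- The differential preserves `B^D`. -/
lemma d_mem_degen {b : B X} (hb : b ∈ degen X) : d X b ∈ degen X := by
  refine closure_stable (d X).toAddMonoidHom ?_ b hb
  rintro _ ⟨u, y, v, rfl⟩
  change d X _ ∈ degen X
  have key : ∀ u ∈ AddSubgroup.closure (Set.range (word (X := X))),
      d X (u * (ge y * ge y) * v) ∈ degen X := by
    intro u hu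
    induction hu using AddSubgroup.closure_induction with
    | mem u hu =>
      obtain ⟨w, rfl⟩ := hu
      induction w with
      | nil =>
        have := ge_sq_mem 1 (d X v) y
        rwa [one_mul, mul_assoc, ← d_ge_sq, ← mul_assoc, ← one_mul (ge y * ge y)] at this
      | cons c w ih =>
        have hm := ge_sq_mem (word w) v y
        cases c with
        | inl x =>
          rw [word_inl, mul_assoc, mul_assoc, d_gx_mul, ← mul_assoc (word w)]
          exact gx_mul_mem _ _ ih
        | inr x =>
          rw [word_inr, mul_assoc, mul_assoc, d_ge_mul, ← mul_assoc (word w), sub_mul, one_mul]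
          exact sub_mem (sub_mem hm (gx_mul_mem _ _ hm)) (ge_mul_mem_degen _ ih)
    | zero => simp
    | add a b _ _ ha hb => rw [add_mul, add_mul, map_add]; exact add_mem ha hb
    | neg a _ ha => rw [neg_mul, neg_mul, map_neg]; exact neg_mem ha
  exact key u (word_span u)

lemma dBar_DBar (n : ℕ) : ∀ b ∈ DBar X (n + 1), dBar X b ∈ DBar X n := by
  rintro _ ⟨b, hb, rfl⟩
  exact ⟨d X b, ⟨d_mem_degen hb.1, d_mem_gr hb.2⟩, rfl⟩

variable (X) in
/-- The differential `B̄^D_{n+1} → B̄^D_n`. -/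
def dDBar (n : ℕ) : DBar X (n + 1) →ₗ[Env X] DBar X n :=
  (dBar X).restrict (dBar_DBar n)

variable (X) in
/-- The differential `B̄^Q_{n+1} → B̄^Q_n`. -/
def dQBar (n : ℕ) : QBar X (n + 1) →ₗ[Env X] QBar X n :=
  Submodule.mapQ _ _ (dGrBar X n) (fun b hb => dBar_DBar n (b : BBar X) hb)

end Spindle

end ShelfBialg

end

open ShelfBialg

/-!
As an abelian group `B` is free on the monomials `m e_{x₁} ⋯ e_{xₙ}` with `m ∈ M(X)`, because the
relations move letters `y` to the left past letters `e_x` without changing the number of either.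
All subobjects except `B^N` are spanned by monomials: `B^D` by those whose word `x₁ ⋯ xₙ` has two
equal neighbours, and `B^+ B^D` by those where this happens after the first letter. Replacing
`e_{x₁} ⋯ e_{xₙ}` by `(e_{x₁} - e_{x₂}) ⋯ (e_{xₙ₋₁} - e_{xₙ}) e_{xₙ}` defines a left `A`-linear
projection onto `B^N` with kernel `B^D`, so `B = B^D ⊕ B^N`. Since `s` doubles the first letter, it
maps the monomials of `B^D` into `B^+ B^D` and all of `B^+` onto the rest of `B^D` modulo
`B^+ B^D`, which turns the complement `B^N` of `B^D` into a complement of `B^L` in `B^D`.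

Every retraction involved is left `A`-linear, hence survives in `B̄ = ℤ ⊗_A B`, which is free on the
words `x₁ ⋯ xₙ` and so is the rack complex. There `d(e_x b) = -e_x d(b)`, which makes `B̄^L`
a subcomplex, whereas `d(e_x e_x b) = e_x e_x d(b)` already in `B`, because `x e_x = e_x x` in a
spindle; this difference of signs is why `d` anticommutes with `s` on `B̄^N`.
-/

noncomputable section

namespace ShelfBialg

section DirectSum

variable {R V W L : Type*} [Ring R] [AddCommGroup V] [Module R V] [AddCommGroup W] [Module R W]
  [AddCommGroup L] [Module R L]

lemma isCompl_submoduleOf {D N G : Submodule R V} (hDN : Disjoint D N) (hG : D ⊔ N = G) :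
    IsCompl (D.submoduleOf G) (N.submoduleOf G) := by
  have hD : D ≤ G := le_sup_left.trans_eq hG
  have hN : N ≤ G := le_sup_right.trans_eq hG
  refine ⟨Submodule.disjoint_def.2 fun g h₁ h₂ => Subtype.ext ?_, codisjoint_iff.2 ?_⟩
  · exact Submodule.disjoint_def.1 hDN _ h₁ h₂
  · rw [← Submodule.submoduleOf_sup_of_le hD hN, hG, Submodule.submoduleOf_self]

section

variable {D N G : Submodule R V} (hDN : Disjoint D N) (hG : D ⊔ N = G)

/-- The section `G / D → V` of the quotient map whose values lie in a complement `N` of `D`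
in `G`. -/
def complSection : (G ⧸ D.submoduleOf G) →ₗ[R] V :=
  G.subtype ∘ₗ (N.submoduleOf G).subtype ∘ₗ
    (Submodule.quotientEquivOfIsCompl _ _ (isCompl_submoduleOf hDN hG)).toLinearMap

lemma complSection_mk (g : G) (hg : (g : V) ∈ N) :
    complSection hDN hG (Submodule.Quotient.mk g) = g :=
  congrArg (fun n : N.submoduleOf G => ((n : G) : V))
    (Submodule.quotientEquivOfIsCompl_apply_mk_right (isCompl_submoduleOf hDN hG) ⟨g, hg⟩)

lemma complSection_injective : Function.Injective (complSection hDN hG) :=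
  Subtype.val_injective.comp (Subtype.val_injective.comp (LinearEquiv.injective _))

lemma range_complSection : LinearMap.range (complSection hDN hG) = N := by
  have hN : N ≤ G := le_sup_right.trans_eq hG
  rw [complSection, LinearMap.range_comp, LinearMap.range_comp, LinearEquiv.range,
    Submodule.map_subtype_top, Submodule.submoduleOf, Submodule.map_comap_subtype,
    inf_eq_right.2 hN]

end

section

variable {D N G : Submodule R V} (hDN : Disjoint D N) (hG : D ⊔ N = G)
  {E : Submodule R W} {j : L →ₗ[R] W} {f : V →ₗ[R] W} (hj : Function.Injective j)
  (hf : Set.InjOn f N) (hd : Disjoint (LinearMap.range j) (N.map f))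
  (hE : LinearMap.range j ⊔ N.map f = E)

/-- If `G = D ⊕ N` and `E = j(L) ⊕ f(N)` with `j` and `f` injective on `L` and `N`, then
`L × G / D ≃ E` by `(l, [b]) ↦ j l + f b`, `b ∈ N`. -/
def prodQuotientEquiv : (L × (G ⧸ D.submoduleOf G)) ≃ₗ[R] E :=
  have hrange : LinearMap.range (f ∘ₗ complSection hDN hG) = N.map f := by
    rw [LinearMap.range_comp, range_complSection]
  have hmem : ∀ q, complSection hDN hG q ∈ N := fun q =>
    (range_complSection hDN hG).le (LinearMap.mem_range_self _ q)
  have hinj : Function.Injective (f ∘ₗ complSection hDN hG) := fun p q h =>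
    complSection_injective hDN hG (hf (hmem p) (hmem q) h)
  (LinearEquiv.ofInjective (j.coprod (f ∘ₗ complSection hDN hG)) (LinearMap.ker_eq_bot.1 <| by
    rw [LinearMap.ker_coprod_of_disjoint_range _ _ (hrange ▸ hd), LinearMap.ker_eq_bot.2 hj,
      LinearMap.ker_eq_bot.2 hinj, Submodule.prod_bot])).trans
  (LinearEquiv.ofEq _ _ (by rw [LinearMap.range_coprod, hrange, hE]))

lemma prodQuotientEquiv_mk (l : L) (g : G) (hg : (g : V) ∈ N) :
    ((prodQuotientEquiv hDN hG hj hf hd hE (l, Submodule.Quotient.mk g) : E) : W) = j l + f g := by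
  simp [prodQuotientEquiv, complSection_mk hDN hG g hg]

end

end DirectSum

section MonomialBasis

variable {X : Type*} [Shelf X]

/-- The right action of the structure monoid on `X` extending `rop`. -/
def ropHom : StrMonoid X →* (Function.End X)ᵐᵒᵖ :=
  PresentedMonoid.lift (fun y => (MulOpposite.op fun x => rop x y : (Function.End X)ᵐᵒᵖ)) (by
    rintro _ _ ⟨x, y⟩
    simp only [map_mul, FreeMonoid.lift_eval_of]
    exact congrArg MulOpposite.op (funext fun z => (rop_rop z x y).symm))

/-- `ropM x m = x ^ m`, the action of an element of the structure monoid. -/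
def ropM (x : X) (m : StrMonoid X) : X := (ropHom m).unop x

lemma ropM_one (x : X) : ropM x 1 = x := by
  rw [ropM, map_one]; rfl

lemma ropM_mul (x : X) (m n : StrMonoid X) : ropM x (m * n) = ropM (ropM x m) n := by
  rw [ropM, map_mul]; rfl

lemma ropM_of (x y : X) : ropM x (PresentedMonoid.of (MRel X) y) = rop x y := rfl

/-- The inclusion of `M(X)` into `A(X) = ℤ M(X)`. -/
def ofM : StrMonoid X →* StrAlg X := MonoidAlgebra.of ℤ (StrMonoid X)

lemma ofM_of (x : X) : ofM (PresentedMonoid.of (MRel X) x) = gA x := rfl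

lemma strMonoid_induction {p : StrMonoid X → Prop} (m : StrMonoid X) (one : p 1)
    (of_mul : ∀ x m, p m → p (PresentedMonoid.of (MRel X) x * m)) : p m := by
  induction m using PresentedMonoid.inductionOn with
  | h w =>
    induction w using FreeMonoid.inductionOn' with
    | one => exact one
    | of_mul x w ih =>
      rw [map_mul]
      exact of_mul x _ ih

lemma ge_mul_incl_ofM (x : X) (m : StrMonoid X) :
    ge x * incl (ofM m) = incl (ofM m) * ge (ropM x m) := by
  induction m using strMonoid_induction generalizing x with
  | one => rw [map_one, map_one, ropM_one, one_mul, mul_one]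
  | of_mul y m ih =>
    rw [map_mul, map_mul, ofM_of, incl_gA, ← mul_assoc, ← ge_rel, mul_assoc, ih, ← mul_assoc,
      ropM_mul, ropM_of]

/-- The product `e_{x₁} ⋯ e_{xₙ}` indexed by a word. -/
def eList (w : List X) : B X := (w.map ge).prod

@[simp] lemma eList_nil : eList ([] : List X) = 1 := rfl

@[simp] lemma eList_cons (x : X) (w : List X) : eList (x :: w) = ge x * eList w := by
  simp [eList]

lemma eList_append (v w : List X) : eList (v ++ w) = eList v * eList w := by simp [eList]

lemma eList_mul_incl_ofM (w : List X) (m : StrMonoid X) :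
    eList w * incl (ofM m) = incl (ofM m) * eList (w.map (ropM · m)) := by
  induction w with
  | nil => simp
  | cons x w ih =>
    rw [eList_cons, mul_assoc, ih, ← mul_assoc, ge_mul_incl_ofM, List.map_cons, eList_cons,
      mul_assoc]

/-- The normal form `m e_{x₁} ⋯ e_{xₙ}` of a monomial of `B(X)`, with `m` in `M(X)`. -/
def monomial (m : StrMonoid X) (w : List X) : B X := incl (ofM m) * eList w

lemma monomial_one (w : List X) : monomial 1 w = eList w := by simp [monomial]

lemma gx_mul_monomial (x : X) (m : StrMonoid X) (w : List X) :
    gx x * monomial m w = monomial (PresentedMonoid.of (MRel X) x * m) w := by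
  rw [monomial, monomial, map_mul, map_mul, ofM_of, incl_gA, mul_assoc]

lemma monomial_mul_monomial (m n : StrMonoid X) (v w : List X) :
    monomial m v * monomial n w = monomial (m * n) (v.map (ropM · n) ++ w) := by
  rw [monomial, monomial, monomial, mul_assoc, ← mul_assoc (eList v), eList_mul_incl_ofM,
    eList_append, map_mul, map_mul]
  simp only [mul_assoc]

lemma exists_word_eq_monomial (u : List (X ⊕ X)) :
    ∃ m w, w.length = deg u ∧ word u = monomial m w := by
  induction u with
  | nil => exact ⟨1, [], rfl, by simp [monomial_one]⟩
  | cons c u ih =>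
    obtain ⟨m, w, hw, hu⟩ := ih
    cases c with
    | inl x => exact ⟨_, w, by simpa using hw, by rw [word_inl, hu, gx_mul_monomial]⟩
    | inr x =>
      refine ⟨m, ropM x m :: w, by simpa using hw, ?_⟩
      rw [word_inr, hu, monomial, monomial, ← mul_assoc, ge_mul_incl_ofM, eList_cons, mul_assoc]

/-- The representation of `B(X)` on the free abelian group on pairs `(m, w)` modelling left
multiplication on the monomials `monomial m w`. -/
def regularRep : B X →+* Module.End ℤ ((StrMonoid X × List X) →₀ ℤ) :=
  lift (fun x => Finsupp.lmapDomain ℤ ℤ fun p => (PresentedMonoid.of (MRel X) x * p.1, p.2))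
    (fun x => Finsupp.lmapDomain ℤ ℤ fun p => (p.1, ropM x p.1 :: p.2))
    (fun x y => by
      have h := PresentedMonoid.mk_eq_mk_of_rel (MRel.rel x y)
      simp only [map_mul] at h
      refine (Finsupp.lmapDomain_comp ..).symm.trans (Eq.trans ?_ (Finsupp.lmapDomain_comp ..))
      congr 1
      funext p
      simp only [Function.comp_apply, ← mul_assoc]
      exact congrArg (fun m => (m * p.1, p.2)) h)
    (fun x y => by
      refine (Finsupp.lmapDomain_comp ..).symm.trans (Eq.trans ?_ (Finsupp.lmapDomain_comp ..))
      congr 1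
      funext p
      simp only [Function.comp_apply, ropM_mul, ropM_of])

lemma regularRep_monomial (m : StrMonoid X) (w : List X) :
    regularRep (monomial m w) (Finsupp.single (1, []) 1) = Finsupp.single (m, w) 1 := by
  induction m using strMonoid_induction with
  | one =>
    induction w with
    | nil => simp [monomial_one]
    | cons x w ih =>
      rw [monomial_one] at ih ⊢
      rw [eList_cons, map_mul, Module.End.mul_apply, ih]
      simp [regularRep, ropM_one]
  | of_mul x m ih =>
    rw [← gx_mul_monomial, map_mul, Module.End.mul_apply, ih]
    simp [regularRep]

variable (X) in
/-- The monomials `m e_{x₁} ⋯ e_{xₙ}` as a basis of `B(X)`. -/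
def monomialBasis : Module.Basis (StrMonoid X × List X) ℤ (B X) :=
  Module.Basis.mk (v := fun p => monomial p.1 p.2)
    (by
      let f : B X →ₗ[ℤ] (StrMonoid X × List X) →₀ ℤ :=
        LinearMap.applyₗ (Finsupp.single (1, []) 1) ∘ₗ (regularRep.toIntAlgHom).toLinearMap
      refine LinearIndependent.of_comp f ?_
      have hf : (f ∘ fun p => monomial p.1 p.2) = fun p => Finsupp.single p 1 :=
        funext fun p => regularRep_monomial p.1 p.2
      rw [hf]
      exact Finsupp.linearIndependent_single_one ℤ _)
    (by
      intro b _
      have h : AddSubgroup.closure (Set.range word) ≤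
          (Submodule.span ℤ (Set.range fun p : StrMonoid X × List X =>
            monomial p.1 p.2)).toAddSubgroup := by
        refine (AddSubgroup.closure_le _).2 ?_
        rintro _ ⟨u, rfl⟩
        obtain ⟨m, w, -, hu⟩ := exists_word_eq_monomial u
        exact Submodule.subset_span ⟨(m, w), hu.symm⟩
      exact h (word_span b))

@[simp] lemma monomialBasis_apply (p : StrMonoid X × List X) :
    monomialBasis X p = monomial p.1 p.2 := by
  simp [monomialBasis]

lemma linearMap_ext {P : Type*} [AddCommGroup P] {f g : B X →ₗ[ℤ] P}
    (h : ∀ m w, f (monomial m w) = g (monomial m w)) : f = g :=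
  (monomialBasis X).ext fun p => by simpa using h p.1 p.2

end MonomialBasis

section LeftLinear

variable {X : Type*} [Shelf X] {M N P : Type*} [AddCommGroup M] [AddCommGroup N] [AddCommGroup P]
  [Module (Env X) M] [Module (Env X) N] [Module (Env X) P]

lemma neg_lact (a : StrAlg X) (m : M) : lact (-a) m = -lact a m := by
  have h : env (-a) 1 = -env a 1 := TensorProduct.neg_tmul _ _
  rw [lact, h, neg_smul, lact]

variable (X) in
/-- Linearity for the left action of `A(X)` only, of an additive map between bimodules. -/
def IsLeftLinear (f : M →ₗ[ℤ] N) : Prop := ∀ (a : StrAlg X) (m : M), f (lact a m) = lact a (f m)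

lemma IsLeftLinear.of_gA {f : M →ₗ[ℤ] N}
    (h : ∀ (x : X) m, f (lact (gA x) m) = lact (gA x) (f m)) : IsLeftLinear X f := by
  intro a m
  induction a using strAlg_induction with
  | h1 => rw [lact_one, lact_one]
  | hx x a ih => rw [lact_mul, lact_mul, h, ih]
  | hadd a b ha hb => rw [add_lact, add_lact, map_add, ha, hb]
  | hneg a ha => rw [neg_lact, neg_lact, map_neg, ha]

lemma isLeftLinear_restrictScalars (f : M →ₗ[Env X] N) :
    IsLeftLinear X (f.restrictScalars ℤ) := fun a m => f.map_smul (env a 1) m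

lemma IsLeftLinear.comp {g : N →ₗ[ℤ] P} {f : M →ₗ[ℤ] N} (hg : IsLeftLinear X g)
    (hf : IsLeftLinear X f) : IsLeftLinear X (g ∘ₗ f) := fun a m => by
  rw [LinearMap.comp_apply, hf, hg, LinearMap.comp_apply]

lemma lact_ofM_eList (m : StrMonoid X) (w : List X) : lact (ofM m) (eList w) = monomial m w :=
  lact_B _ _

/-- The left `A(X)`-linear map with prescribed values on the products `e_{x₁} ⋯ e_{xₙ}`. -/
def extend (φ : List X → P) : B X →ₗ[ℤ] P :=
  (monomialBasis X).constr ℤ fun p => lact (ofM p.1) (φ p.2)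

@[simp] lemma extend_monomial (φ : List X → P) (m : StrMonoid X) (w : List X) :
    extend φ (monomial m w) = lact (ofM m) (φ w) := by
  rw [extend, ← monomialBasis_apply (m, w), Module.Basis.constr_basis]

@[simp] lemma extend_eList (φ : List X → P) (w : List X) : extend φ (eList w) = φ w := by
  rw [← monomial_one, extend_monomial, map_one, lact_one]

lemma isLeftLinear_extend (φ : List X → P) : IsLeftLinear X (extend φ) := by
  refine .of_gA fun x b => ?_
  have h : extend φ ∘ₗ DistribSMul.toLinearMap ℤ (B X) (env (gA x) 1) =
      DistribSMul.toLinearMap ℤ P (env (gA x) 1) ∘ₗ extend φ := by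
    refine linearMap_ext fun m w => ?_
    change extend φ (lact (gA x) (monomial m w)) = lact (gA x) (extend φ (monomial m w))
    rw [lact_B, incl_gA, gx_mul_monomial, extend_monomial, extend_monomial, map_mul, lact_mul,
      ofM_of]
  exact LinearMap.congr_fun h b

end LeftLinear

section WordSpan

variable {X : Type*} [Shelf X] {P Q R : List X → Prop}

/-- The span of the monomials `m e_{x₁} ⋯ e_{xₙ}` whose word `x₁ ⋯ xₙ` satisfies `P`. -/
def wordSpan (P : List X → Prop) : Submodule ℤ (B X) :=
  Submodule.span ℤ (monomialBasis X '' {p | P p.2})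

lemma monomial_mem_wordSpan (m : StrMonoid X) {w : List X} (hw : P w) :
    monomial m w ∈ wordSpan P :=
  Submodule.subset_span ⟨(m, w), hw, monomialBasis_apply _⟩

lemma eList_mem_wordSpan {w : List X} (hw : P w) : eList w ∈ wordSpan P :=
  monomial_one w ▸ monomial_mem_wordSpan 1 hw

lemma wordSpan_le {T : Submodule ℤ (B X)} :
    wordSpan P ≤ T ↔ ∀ m w, P w → monomial m w ∈ T := by
  simp [wordSpan, Submodule.span_le, Set.subset_def, Set.forall_mem_image, -Set.mem_image]

lemma wordSpan_inf : wordSpan P ⊓ wordSpan Q = wordSpan fun w => P w ∧ Q w := by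
  ext b
  simp only [wordSpan, Submodule.mem_inf, Module.Basis.mem_span_image, ← Set.subset_inter_iff]
  rfl

lemma wordSpan_true : wordSpan (fun _ : List X => True) = ⊤ := by
  rw [wordSpan, ← (monomialBasis X).span_eq, ← Set.image_univ]
  rfl

lemma mul_mem_wordSpan (h : ∀ v w m, P v → Q w → R (v.map (ropM · m) ++ w)) {a b : B X}
    (ha : a ∈ wordSpan P) (hb : b ∈ wordSpan Q) : a * b ∈ wordSpan R := by
  have hle : wordSpan P * wordSpan Q ≤ wordSpan R := by
    rw [wordSpan, wordSpan, Submodule.span_mul_span, Submodule.span_le]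
    rintro _ ⟨_, ⟨p, hp, rfl⟩, _, ⟨q, hq, rfl⟩, rfl⟩
    simp only [monomialBasis_apply, monomial_mul_monomial]
    exact monomial_mem_wordSpan _ (h _ _ _ hp hq)
  exact hle (Submodule.mul_mem_mul ha hb)

lemma IsLeftLinear.eq_of_mem_wordSpan {N : Type*} [AddCommGroup N] [Module (Env X) N]
    {f g : B X →ₗ[ℤ] N} (hf : IsLeftLinear X f) (hg : IsLeftLinear X g)
    (h : ∀ w, P w → f (eList w) = g (eList w)) {b : B X} (hb : b ∈ wordSpan P) : f b = g b := by
  refine LinearMap.eqOn_span' (fun _ => ?_) hb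
  rintro ⟨p, hp, rfl⟩
  rw [monomialBasis_apply, ← lact_ofM_eList, hf, hg, h _ hp]

/-- The sub-bimodule `S` of `B(X)` is spanned by the monomials whose word satisfies `P`. -/
def IsWordSpan (S : Submodule (Env X) (B X)) (P : List X → Prop) : Prop :=
  S.restrictScalars ℤ = wordSpan P

namespace IsWordSpan

variable {S T : Submodule (Env X) (B X)}

lemma mem_iff (hS : IsWordSpan S P) {b : B X} : b ∈ S ↔ b ∈ wordSpan P :=
  SetLike.ext_iff.1 hS b

lemma monomial_mem (hS : IsWordSpan S P) (m : StrMonoid X) {w : List X} (hw : P w) :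
    monomial m w ∈ S :=
  hS.mem_iff.2 (monomial_mem_wordSpan m hw)

lemma eList_mem (hS : IsWordSpan S P) {w : List X} (hw : P w) : eList w ∈ S :=
  hS.mem_iff.2 (eList_mem_wordSpan hw)

lemma le_of_eList_mem (hS : IsWordSpan S P) (h : ∀ w, P w → eList w ∈ T) : S ≤ T := by
  have hle : wordSpan P ≤ T.restrictScalars ℤ := wordSpan_le.2 fun m w hw =>
    lact_ofM_eList m w ▸ T.smul_mem _ (h w hw)
  exact fun b hb => hle (hS.mem_iff.1 hb)

lemma of_le (h₁ : ∀ w, P w → eList w ∈ S) (h₂ : ∀ b ∈ S, b ∈ wordSpan P) : IsWordSpan S P :=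
  le_antisymm h₂ (wordSpan_le.2 fun m w hw => lact_ofM_eList m w ▸ S.smul_mem _ (h₁ w hw))

lemma inf (hS : IsWordSpan S P) (hT : IsWordSpan T Q) :
    IsWordSpan (S ⊓ T) fun w => P w ∧ Q w := by
  have hS' : S.restrictScalars ℤ = wordSpan P := hS
  have hT' : T.restrictScalars ℤ = wordSpan Q := hT
  rw [IsWordSpan, ← wordSpan_inf, ← hS', ← hT']
  rfl

lemma addMonoidHom_ext {N : Type*} [AddCommGroup N] (hS : IsWordSpan S P) {f g : S →+ N}
    (h : ∀ m w (hw : P w), f ⟨monomial m w, hS.monomial_mem m hw⟩ =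
      g ⟨monomial m w, hS.monomial_mem m hw⟩) : f = g := by
  have key : ∀ b ∈ wordSpan P, ∀ hb : b ∈ S, f ⟨b, hb⟩ = g ⟨b, hb⟩ := by
    intro b hb
    have hmem : ∀ {c}, c ∈ wordSpan P → c ∈ S := hS.mem_iff.2
    induction hb using Submodule.span_induction with
    | mem c hc =>
      obtain ⟨p, hp, rfl⟩ := hc
      simpa using fun _ => h p.1 p.2 hp
    | zero => exact fun hb => (map_zero f).trans (map_zero g).symm
    | add c c' hc hc' ih ih' =>
      exact fun _ => (map_add f ⟨c, hmem hc⟩ ⟨c', hmem hc'⟩).trans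
        ((congrArg₂ _ (ih _) (ih' _)).trans (map_add g _ _).symm)
    | smul n c hc ih =>
      exact fun _ => (map_zsmul f n ⟨c, hmem hc⟩).trans
        ((congrArg _ (ih _)).trans (map_zsmul g n _).symm)
  ext b
  exact key b (hS.mem_iff.1 b.2) b.2

end IsWordSpan

end WordSpan

section Degenerate

variable {X : Type*}

/-- The word `w` has two equal neighbours. -/
def HasRepeat (w : List X) : Prop := ∃ x, [x, x] <:+: w

lemma hasRepeat_cons_cons {x y : X} {w : List X} :
    HasRepeat (x :: y :: w) ↔ x = y ∨ HasRepeat (y :: w) := by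
  simp only [HasRepeat, List.infix_cons_iff (a := x), List.cons_prefix_cons, List.nil_prefix,
    and_true, exists_or]
  simp

lemma hasRepeat_cons_cons_self (x : X) (w : List X) : HasRepeat (x :: x :: w) :=
  hasRepeat_cons_cons.2 (.inl rfl)

lemma HasRepeat.of_infix {v w : List X} (hv : HasRepeat v) (h : v <:+: w) : HasRepeat w :=
  hv.imp fun _ hx => hx.trans h

lemma HasRepeat.of_tail {w : List X} (hw : HasRepeat w.tail) : HasRepeat w :=
  hw.of_infix (List.tail_suffix w).isInfix

lemma HasRepeat.map {Y : Type*} {w : List X} (hw : HasRepeat w) (f : X → Y) :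
    HasRepeat (w.map f) := by
  obtain ⟨x, hx⟩ := hw
  exact ⟨f x, hx.map f⟩

lemma HasRepeat.two_le_length {w : List X} (hw : HasRepeat w) : 2 ≤ w.length := by
  obtain ⟨x, hx⟩ := hw
  exact hx.length_le

lemma exists_tail_eq_cons_of_hasRepeat_tail {w : List X} (hw : HasRepeat w.tail) :
    ∃ x v, w = x :: v ∧ HasRepeat v := by
  cases w with
  | nil => exact absurd hw.two_le_length (by simp)
  | cons x v => exact ⟨x, v, rfl, hw⟩

variable [Shelf X]

lemma diffWord_eq_zero {w : List X} (hw : HasRepeat w) : diffWord w = 0 := by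
  induction w with
  | nil => exact absurd hw.two_le_length (by simp)
  | cons x w ih =>
    cases w with
    | nil => exact absurd hw.two_le_length (by simp)
    | cons y w =>
      rcases hasRepeat_cons_cons.1 hw with rfl | h
      · rw [diffWord, sub_self, zero_mul]
      · rw [diffWord, ih h, mul_zero]

lemma mem_wordSpan_true (b : B X) : b ∈ wordSpan fun _ => True := by
  rw [wordSpan_true]
  exact Submodule.mem_top

lemma isWordSpan_gr (n : ℕ) : IsWordSpan (gr X n) (·.length = n) := by
  refine .of_le (fun w hw => ?_) fun b hb => ?_
  · induction w generalizing n with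
    | nil =>
      subst hw
      exact word_mem_gr []
    | cons x w ih =>
      subst hw
      exact eList_cons x w ▸ ge_mul_mem_gr x (ih _ rfl)
  · have h : AddSubgroup.closure {b | ∃ u, deg u = n ∧ b = word u} ≤
        (wordSpan (X := X) fun w => w.length = n).toAddSubgroup := by
      refine (AddSubgroup.closure_le _).2 ?_
      rintro _ ⟨u, hu, rfl⟩
      obtain ⟨m, w, hw, h⟩ := exists_word_eq_monomial u
      rw [h]
      exact monomial_mem_wordSpan (P := fun w => w.length = n) m (hw.trans hu)
    exact h hb

lemma mul_mem_gr {k n : ℕ} {a b : B X} (ha : a ∈ gr X k) (hb : b ∈ gr X n) :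
    a * b ∈ gr X (k + n) := by
  rw [(isWordSpan_gr _).mem_iff] at ha hb ⊢
  exact mul_mem_wordSpan (fun v w m hv hw => by simp [hv, hw]) ha hb

lemma isWordSpan_pos : IsWordSpan (pos X) (· ≠ []) := by
  refine .of_le (fun w hw => ?_) fun b hb => ?_
  · obtain ⟨x, v, rfl⟩ := List.exists_cons_of_ne_nil hw
    exact le_iSup (fun n => gr X (n + 1)) v.length ((isWordSpan_gr _).eList_mem rfl)
  · have hle : ∀ n, (gr X (n + 1)).restrictScalars ℤ ≤ wordSpan (· ≠ []) := fun n =>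
      (isWordSpan_gr (n + 1)).le.trans <| wordSpan_le.2 fun m w hw =>
        monomial_mem_wordSpan m (List.ne_nil_of_length_eq_add_one hw)
    induction hb using Submodule.iSup_induction' with
    | mem n b hb => exact hle n hb
    | zero => exact zero_mem _
    | add b c _ _ hb hc => exact add_mem hb hc

lemma isWordSpan_degen : IsWordSpan (degen X) HasRepeat := by
  refine .of_le (fun w ⟨x, u, v, hw⟩ => ?_) fun b hb => ?_
  · refine AddSubgroup.subset_closure ⟨eList u, x, eList v, ?_⟩
    rw [← hw, eList_append, eList_append]
    simp
  · have h : AddSubgroup.closure {b | ∃ u x v, b = u * (ge x * ge x) * v} ≤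
        (wordSpan (X := X) HasRepeat).toAddSubgroup := by
      refine (AddSubgroup.closure_le _).2 ?_
      rintro _ ⟨u, x, v, rfl⟩
      have hsq : ge x * ge x ∈ wordSpan HasRepeat := by
        simpa using eList_mem_wordSpan (w := [x, x]) ⟨x, List.infix_rfl⟩
      refine mul_mem_wordSpan (R := HasRepeat) (fun v w m hv _ => ?_)
        (mul_mem_wordSpan (R := HasRepeat) (fun v w m _ hw => ?_) (mem_wordSpan_true u) hsq)
        (mem_wordSpan_true v)
      · exact (hv.map _).of_infix (List.prefix_append _ _).isInfix
      · exact hw.of_infix (List.suffix_append _ _).isInfix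
    exact h hb

lemma mul_mem_degen_right (a : B X) {b : B X} (hb : b ∈ degen X) : a * b ∈ degen X := by
  rw [isWordSpan_degen.mem_iff] at hb ⊢
  exact mul_mem_wordSpan (fun v w m _ hw => hw.of_infix (List.suffix_append _ _).isInfix)
    (mem_wordSpan_true a) hb

lemma isWordSpan_DGr (n : ℕ) : IsWordSpan (DGr X n) fun w => HasRepeat w ∧ w.length = n :=
  isWordSpan_degen.inf (isWordSpan_gr n)

lemma DGr_eq_bot {n : ℕ} (hn : n < 2) : DGr X n = ⊥ :=
  le_bot_iff.1 <| (isWordSpan_DGr n).le_of_eList_mem fun _ ⟨hw, hl⟩ =>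
    absurd (hl ▸ hw.two_le_length) hn.not_ge

end Degenerate

section Late

variable {X : Type*} [Shelf X]

lemma TensorA.induction_on {M N : Type*} [AddCommGroup M] [AddCommGroup N] [Module (Env X) M]
    [Module (Env X) N] {p : TensorA X M N → Prop} (t : TensorA X M N) (zero : p 0)
    (tmul : ∀ m n, p (tmulA m n)) (add : ∀ t u, p t → p u → p (t + u)) : p t := by
  obtain ⟨t, rfl⟩ := QuotientAddGroup.mk'_surjective (balanced X M N) t
  induction t using TensorProduct.induction_on with
  | zero => exact (map_zero (QuotientAddGroup.mk' (balanced X M N))).symm ▸ zero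
  | tmul m n => exact tmul m n
  | add t u ht hu =>
    exact (map_add (QuotientAddGroup.mk' (balanced X M N)) t u).symm ▸ add _ _ ht hu

lemma ge_mem_gr_one (x : X) : ge x ∈ gr X 1 := by
  simpa using (isWordSpan_gr 1).eList_mem (w := [x]) rfl

/-- The generator `e_x ⊗ e_{x₁} ⋯ e_{xₙ}` of `B^L`, for a word `x₁ ⋯ xₙ` with two equal
neighbours. -/
def lateGen (x : X) {w : List X} (hw : HasRepeat w) : BL X :=
  tmulA ⟨ge x, ge_mem_gr_one x⟩ ⟨eList w, isWordSpan_degen.eList_mem hw⟩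

lemma mulMap_lateGen (x : X) {w : List X} (hw : HasRepeat w) :
    mulMap X (lateGen x hw) = eList (x :: w) := by
  simp [lateGen]

lemma isWordSpan_range_mulMap :
    IsWordSpan (LinearMap.range (mulMap X)) fun w => HasRepeat w.tail := by
  refine .of_le (fun w hw => ?_) fun b hb => ?_
  · obtain ⟨x, v, rfl, hv⟩ := exists_tail_eq_cons_of_hasRepeat_tail hw
    exact ⟨lateGen x hv, mulMap_lateGen x hv⟩
  · obtain ⟨t, rfl⟩ := hb
    induction t using TensorA.induction_on with
    | zero => simp
    | tmul b c =>
      refine mul_mem_wordSpan (fun v w m hv hw => ?_) ((isWordSpan_gr 1).mem_iff.1 b.2)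
        (isWordSpan_degen.mem_iff.1 c.2)
      obtain ⟨x, rfl⟩ := List.length_eq_one_iff.1 hv
      exact hw
    | add t u ht hu =>
      rw [map_add]
      exact add_mem ht hu

lemma range_mulMap_le_degen : LinearMap.range (mulMap X) ≤ degen X :=
  isWordSpan_range_mulMap.le_of_eList_mem fun _ hw => isWordSpan_degen.eList_mem hw.of_tail

lemma range_mulMap_eq_span : LinearMap.range (mulMap X) =
    Submodule.span (Env X) {t | ∃ b ∈ pos X, ∃ c ∈ degen X, t = b * c} := by
  refine le_antisymm (isWordSpan_range_mulMap.le_of_eList_mem fun w hw => ?_) ?_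
  · obtain ⟨x, v, rfl, hv⟩ := exists_tail_eq_cons_of_hasRepeat_tail hw
    exact Submodule.subset_span ⟨ge x, le_iSup (fun n => gr X (n + 1)) 0 (ge_mem_gr_one x),
      eList v, isWordSpan_degen.eList_mem hv, eList_cons x v⟩
  · refine Submodule.span_le.2 ?_
    rintro _ ⟨b, hb, c, hc, rfl⟩
    rw [isWordSpan_pos.mem_iff] at hb
    rw [isWordSpan_degen.mem_iff] at hc
    refine isWordSpan_range_mulMap.mem_iff.2 (mul_mem_wordSpan (fun v w m hv hw => ?_) hb hc)
    obtain ⟨x, v, rfl⟩ := List.exists_cons_of_ne_nil hv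
    exact hw.of_infix (List.suffix_append _ _).isInfix

lemma map_mulMap_LGr (n : ℕ) :
    (LGr X n).map (mulMap X) = LinearMap.range (mulMap X) ⊓ gr X n := by
  refine le_antisymm ((Submodule.map_span_le _ _ _).2 ?_)
    ((isWordSpan_range_mulMap.inf (isWordSpan_gr n)).le_of_eList_mem fun w ⟨hw, hl⟩ => ?_)
  · rintro _ ⟨b, c, m, rfl, hc, rfl⟩
    exact ⟨LinearMap.mem_range_self _ _, add_comm 1 m ▸ mul_mem_gr b.2 hc⟩
  · obtain ⟨x, v, rfl, hv⟩ := exists_tail_eq_cons_of_hasRepeat_tail hw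
    exact ⟨lateGen x hv, Submodule.subset_span ⟨_, _, v.length, hl,
      (isWordSpan_gr _).eList_mem rfl, rfl⟩, mulMap_lateGen x hv⟩

lemma lact_tmulA {M N : Type*} [AddCommGroup M] [AddCommGroup N] [Module (Env X) M]
    [Module (Env X) N] (a : StrAlg X) (m : M) (n : N) :
    lact a (tmulA (X := X) m n) = tmulA (lact a m) n := by
  rw [lact, env_smul_tmulA, ract_one]

lemma tmulA_monomial_monomial (m n : StrMonoid X) (x : X) {w : List X} (hw : HasRepeat w) :
    (tmulA ⟨monomial m [x], (isWordSpan_gr 1).monomial_mem m rfl⟩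
      ⟨monomial n w, isWordSpan_degen.monomial_mem n hw⟩ : BL X) =
      lact (ofM (m * n)) (lateGen (ropM x n) hw) := by
  have h₁ : (⟨monomial n w, isWordSpan_degen.monomial_mem n hw⟩ : degen X) =
      lact (ofM n) ⟨eList w, isWordSpan_degen.eList_mem hw⟩ := by
    refine Subtype.ext ?_
    rw [coe_lact]
    rfl
  have h₂ : (ract ⟨monomial m [x], (isWordSpan_gr 1).monomial_mem m rfl⟩ (ofM n) : gr X 1) =
      lact (ofM (m * n)) ⟨ge (ropM x n), ge_mem_gr_one _⟩ := by
    refine Subtype.ext ?_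
    rw [coe_ract, coe_lact]
    change monomial m [x] * _ = incl (ofM (m * n)) * ge (ropM x n)
    rw [monomial, mul_assoc, eList_mul_incl_ofM, map_mul, map_mul, mul_assoc]
    simp
  rw [h₁, ← tmulA_ract, h₂, lateGen, lact_tmulA]

lemma IsLeftLinear.ext_lateGen {N : Type*} [AddCommGroup N] [Module (Env X) N]
    {f g : BL X →ₗ[ℤ] N} (hf : IsLeftLinear X f) (hg : IsLeftLinear X g)
    (h : ∀ x w (hw : HasRepeat w), f (lateGen x hw) = g (lateGen x hw)) : f = g := by
  let curry (φ : BL X →ₗ[ℤ] N) : gr X 1 →+ degen X →+ N :=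
    AddMonoidHom.mk' (fun b => AddMonoidHom.mk' (fun c => φ (tmulA b c)) fun c c' => by
      rw [tmulA_add_right, map_add]) fun b b' => by
        ext c
        exact (congrArg φ (tmulA_add_left b b' c)).trans (map_add φ _ _)
  suffices hc : curry f = curry g from
    LinearMap.toAddMonoidHom_injective <| TensorA.hom_ext fun b c =>
      DFunLike.congr_fun (DFunLike.congr_fun hc b) c
  refine (isWordSpan_gr 1).addMonoidHom_ext fun m v hv => ?_
  obtain ⟨x, rfl⟩ := List.length_eq_one_iff.1 hv
  refine isWordSpan_degen.addMonoidHom_ext fun n w hw => ?_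
  change f (tmulA _ _) = g (tmulA _ _)
  rw [tmulA_monomial_monomial m n x hw, hf, hg, h]

open Classical in
/-- The element of `B^L` over `e_{x₁} ⋯ e_{xₙ}` if `x₂ ⋯ xₙ` has two equal neighbours, else `0`. -/
def lateWord : List X → BL X
  | [] => 0
  | x :: w => if hw : HasRepeat w then lateGen x hw else 0

lemma extend_lateWord_mulMap (t : BL X) : extend lateWord (mulMap X t) = t := by
  have h : extend lateWord ∘ₗ (mulMap X).restrictScalars ℤ = LinearMap.id :=
    IsLeftLinear.ext_lateGen
      ((isLeftLinear_extend _).comp (isLeftLinear_restrictScalars _)) (fun _ _ => rfl)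
      fun x w hw => by
        rw [LinearMap.comp_apply, LinearMap.restrictScalars_apply, mulMap_lateGen, extend_eList,
          lateWord, dif_pos hw, LinearMap.id_apply]
  exact LinearMap.congr_fun h t

lemma mulMap_injective : Function.Injective (mulMap X) :=
  Function.LeftInverse.injective extend_lateWord_mulMap

end Late

section Degeneracy

variable {X : Type*} [Shelf X]

lemma s_eList_cons (x : X) (w : List X) : s X (eList (x :: w)) = eList (x :: x :: w) := by
  simp [mul_assoc]

lemma s_mem_DGr (n : ℕ) : ∀ b ∈ gr X (n + 1), s X b ∈ DGr X (n + 2) := by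
  refine (isWordSpan_gr (n + 1)).le_of_eList_mem (T := (DGr X (n + 2)).comap (s X)) fun w hw => ?_
  obtain ⟨x, v, rfl⟩ := List.exists_cons_of_length_eq_add_one hw
  rw [Submodule.mem_comap, s_eList_cons]
  exact (isWordSpan_DGr _).eList_mem ⟨hasRepeat_cons_cons_self x v, congrArg (· + 1) hw⟩

lemma s_mem_degen : ∀ b ∈ pos X, s X b ∈ degen X := by
  refine isWordSpan_pos.le_of_eList_mem (T := (degen X).comap (s X)) fun w hw => ?_
  obtain ⟨x, v, rfl⟩ := List.exists_cons_of_ne_nil hw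
  rw [Submodule.mem_comap, s_eList_cons]
  exact isWordSpan_degen.eList_mem (hasRepeat_cons_cons_self x v)

lemma s_injOn_pos : Set.InjOn (s X) (pos X : Set (B X)) := by
  let f : B X →ₗ[ℤ] B X := extend fun w => eList w.tail
  have hleft : ∀ b ∈ pos X, f (s X b) = b := fun b hb => by
    refine IsLeftLinear.eq_of_mem_wordSpan (f := f ∘ₗ (s X).restrictScalars ℤ) (g := LinearMap.id)
      ((isLeftLinear_extend _).comp (isLeftLinear_restrictScalars (s X))) (fun _ _ => rfl)
      (fun w hw => ?_) (isWordSpan_pos.mem_iff.1 hb)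
    obtain ⟨x, v, rfl⟩ := List.exists_cons_of_ne_nil hw
    exact (congrArg f (s_eList_cons x v)).trans (extend_eList _ _)
  exact Set.LeftInvOn.injOn (f₁' := f) hleft

end Degeneracy

section Complement

variable {X : Type*} [Shelf X]

lemma diffWord_mem_BN (w : List X) : diffWord w ∈ BN X :=
  AddSubgroup.subset_closure ⟨1, w, by simp⟩

lemma IsLeftLinear.eq_of_mem_BN {N : Type*} [AddCommGroup N] [Module (Env X) N]
    {f g : B X →ₗ[ℤ] N} (hf : IsLeftLinear X f) (hg : IsLeftLinear X g)
    (h : ∀ w, f (diffWord w) = g (diffWord w)) {b : B X} (hb : b ∈ BN X) : f b = g b := by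
  refine AddMonoidHom.eqOn_closure (f := f.toAddMonoidHom) (g := g.toAddMonoidHom) ?_ hb
  rintro _ ⟨a, w, rfl⟩
  change f (incl a * diffWord w) = g (incl a * diffWord w)
  rw [← lact_B, hf, hg, h]

lemma eList_sub_diffWord_mem (w : List X) : eList w - diffWord w ∈ DGr X w.length := by
  induction w with
  | nil => simp [diffWord]
  | cons x w ih =>
    have hmul : ∀ y, ∀ b ∈ DGr X w.length, ge y * b ∈ DGr X (w.length + 1) := fun y b hb =>
      ⟨mul_mem_degen_right _ hb.1, ge_mul_mem_gr y hb.2⟩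
    cases w with
    | nil => simp [diffWord]
    | cons y w =>
      have hrep : ge y * eList (y :: w) ∈ DGr X (w.length + 2) :=
        eList_cons y (y :: w) ▸
          (isWordSpan_DGr _).eList_mem ⟨hasRepeat_cons_cons_self y w, rfl⟩
      have h : eList (x :: y :: w) - diffWord (x :: y :: w) =
          ge x * (eList (y :: w) - diffWord (y :: w)) + (ge y * eList (y :: w) -
            ge y * (eList (y :: w) - diffWord (y :: w))) := by
        rw [eList_cons, diffWord]
        noncomm_ring
      rw [h]
      exact add_mem (hmul x _ ih) (sub_mem hrep (hmul y _ ih))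

lemma diffWord_mem_NGr (w : List X) : diffWord w ∈ NGr X w.length :=
  ⟨diffWord_mem_BN w, sub_sub_cancel (eList w) (diffWord w) ▸
    sub_mem ((isWordSpan_gr _).eList_mem rfl) (eList_sub_diffWord_mem w).2⟩

/-- The projection of `B` onto `B^N` along `B^D`. -/
def projN : B X →ₗ[ℤ] B X := extend diffWord

lemma isLeftLinear_projN : IsLeftLinear X (projN (X := X)) := isLeftLinear_extend _

lemma projN_eList (w : List X) : projN (eList w) = diffWord w := extend_eList _ _

lemma projN_eq_zero {b : B X} (hb : b ∈ degen X) : projN b = 0 :=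
  IsLeftLinear.eq_of_mem_wordSpan (g := 0) isLeftLinear_projN (fun _ _ => (smul_zero _).symm)
    (fun w hw => (projN_eList w).trans (diffWord_eq_zero hw)) (isWordSpan_degen.mem_iff.1 hb)

lemma projN_eq_self {b : B X} (hb : b ∈ BN X) : projN b = b := by
  refine IsLeftLinear.eq_of_mem_BN (g := LinearMap.id) isLeftLinear_projN (fun _ _ => rfl)
    (fun w => ?_) hb
  have h := projN_eq_zero (eList_sub_diffWord_mem w).1
  rw [map_sub, projN_eList, sub_eq_zero] at h
  exact h.symm

lemma disjoint_degen_BN : Disjoint (degen X) (BN X) :=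
  Submodule.disjoint_def.2 fun _ hD hN => (projN_eq_self hN).symm.trans (projN_eq_zero hD)

lemma disjoint_DGr_NGr (n : ℕ) : Disjoint (DGr X n) (NGr X n) :=
  disjoint_degen_BN.mono inf_le_left inf_le_left

lemma DGr_sup_NGr (n : ℕ) : DGr X n ⊔ NGr X n = gr X n := by
  refine le_antisymm (sup_le inf_le_right inf_le_right) ((isWordSpan_gr n).le_of_eList_mem ?_)
  rintro w rfl
  exact Submodule.mem_sup.2 ⟨_, eList_sub_diffWord_mem w, _, diffWord_mem_NGr w,
    sub_add_cancel _ _⟩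

lemma gr_succ_le_pos (n : ℕ) : gr X (n + 1) ≤ pos X := le_iSup (fun n => gr X (n + 1)) n

open Classical in
/-- `(e_y - e_{x₁}) ⋯` for the word `y y x₁ ⋯`, and `0` unless the word starts with a repeated
letter. -/
def unrepeatWord : List X → B X
  | x :: y :: w => if x = y then diffWord (y :: w) else 0
  | _ => 0

/-- The left linear map undoing `s` on `(B^N)⁺` and killing `B^L`. -/
def unrepeat : B X →ₗ[ℤ] B X := extend unrepeatWord

lemma isLeftLinear_unrepeat : IsLeftLinear X (unrepeat (X := X)) := isLeftLinear_extend _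

lemma unrepeat_eq_zero {b : B X} (hb : b ∈ LinearMap.range (mulMap X)) : unrepeat b = 0 := by
  refine IsLeftLinear.eq_of_mem_wordSpan (g := 0) isLeftLinear_unrepeat
    (fun _ _ => (smul_zero _).symm) (fun w hw => ?_) (isWordSpan_range_mulMap.mem_iff.1 hb)
  obtain ⟨x, v, rfl, hv⟩ := exists_tail_eq_cons_of_hasRepeat_tail hw
  obtain ⟨y, u, rfl⟩ := List.exists_cons_of_length_pos (two_pos.trans_le hv.two_le_length)
  rw [unrepeat, extend_eList, unrepeatWord, diffWord_eq_zero hv, ite_self, LinearMap.zero_apply]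

lemma unrepeat_s {b : B X} (hN : b ∈ BN X) (hpos : b ∈ pos X) : unrepeat (s X b) = b := by
  refine Eq.trans ?_ (projN_eq_self hN)
  refine IsLeftLinear.eq_of_mem_wordSpan (f := unrepeat ∘ₗ (s X).restrictScalars ℤ)
    (isLeftLinear_unrepeat.comp (isLeftLinear_restrictScalars _)) isLeftLinear_projN
    (fun w hw => ?_) (isWordSpan_pos.mem_iff.1 hpos)
  obtain ⟨x, v, rfl⟩ := List.exists_cons_of_ne_nil hw
  rw [LinearMap.comp_apply, LinearMap.restrictScalars_apply, s_eList_cons, projN_eList, unrepeat,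
    extend_eList, unrepeatWord, if_pos rfl]

lemma disjoint_range_mulMap_map_s :
    Disjoint (LinearMap.range (mulMap X)) ((BN X ⊓ pos X).map (s X)) := by
  refine Submodule.disjoint_def.2 ?_
  rintro _ hL ⟨b, ⟨hN, hpos⟩, rfl⟩
  rw [← unrepeat_s hN hpos, unrepeat_eq_zero hL, map_zero]

lemma s_mem_map_mulMap {n : ℕ} : ∀ b ∈ DGr X (n + 1),
    s X b ∈ (LGr X (n + 2)).map (mulMap X) := by
  rw [map_mulMap_LGr]
  refine (isWordSpan_DGr _).le_of_eList_mem
    (T := (LinearMap.range (mulMap X) ⊓ gr X (n + 2)).comap (s X)) fun w ⟨hw, hl⟩ => ?_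
  obtain ⟨x, v, rfl⟩ := List.exists_cons_of_length_eq_add_one hl
  rw [Submodule.mem_comap, s_eList_cons]
  exact (isWordSpan_range_mulMap.inf (isWordSpan_gr _)).eList_mem ⟨hw, congrArg (· + 1) hl⟩

lemma disjoint_map_mulMap_map_s (n : ℕ) :
    Disjoint ((LGr X (n + 2)).map (mulMap X)) ((NGr X (n + 1)).map (s X)) :=
  disjoint_range_mulMap_map_s.mono LinearMap.map_le_range
    (Submodule.map_mono (inf_le_inf_left _ (gr_succ_le_pos n)))

lemma map_mulMap_sup_map_s (n : ℕ) :
    (LGr X (n + 2)).map (mulMap X) ⊔ (NGr X (n + 1)).map (s X) = DGr X (n + 2) := by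
  refine le_antisymm (sup_le ?_ ?_) ((isWordSpan_DGr _).le_of_eList_mem fun w ⟨hw, hl⟩ => ?_)
  · rw [map_mulMap_LGr]
    exact inf_le_inf_right _ range_mulMap_le_degen
  · exact Submodule.map_le_iff_le_comap.2 fun b hb => s_mem_DGr n b hb.2
  obtain ⟨x, y, v, rfl⟩ : ∃ x y v, w = x :: y :: v := by
    match w, hl with
    | x :: y :: v, _ => exact ⟨x, y, v, rfl⟩
  obtain rfl : v.length = n := by simpa using hl
  rcases hasRepeat_cons_cons.1 hw with rfl | h
  · have hD : eList (x :: v) - diffWord (x :: v) ∈ DGr X (v.length + 1) :=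
      eList_sub_diffWord_mem (x :: v)
    have hN : diffWord (x :: v) ∈ NGr X (v.length + 1) := diffWord_mem_NGr (x :: v)
    rw [← s_eList_cons, ← sub_add_cancel (eList (x :: v)) (diffWord (x :: v)), map_add]
    exact Submodule.add_mem_sup (s_mem_map_mulMap _ hD) (Submodule.mem_map_of_mem hN)
  · rw [map_mulMap_LGr]
    exact Submodule.mem_sup_left
      ((isWordSpan_range_mulMap.inf (isWordSpan_gr _)).eList_mem ⟨h, rfl⟩)

lemma range_mulMap_sup_map_s :
    LinearMap.range (mulMap X) ⊔ (BN X ⊓ pos X).map (s X) = degen X := by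
  refine le_antisymm (sup_le range_mulMap_le_degen ?_)
    (isWordSpan_degen.le_of_eList_mem fun w hw => ?_)
  · exact Submodule.map_le_iff_le_comap.2 fun b hb => s_mem_degen b hb.2
  · obtain ⟨n, hn⟩ := Nat.exists_eq_add_of_le' hw.two_le_length
    have hmem : eList w ∈ DGr X (n + 2) := (isWordSpan_DGr _).eList_mem ⟨hw, hn⟩
    have hle : DGr X (n + 2) ≤ LinearMap.range (mulMap X) ⊔ (BN X ⊓ pos X).map (s X) :=
      (map_mulMap_sup_map_s n).ge.trans <| sup_le_sup LinearMap.map_le_range <|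
        Submodule.map_mono <| inf_le_inf_left _ <| gr_succ_le_pos n
    exact hle hmem

variable (X) in
/-- The isomorphism `B^L_n ⊕ B^Q_{n-1} ≃ B^D_n`, `(l, [b]) ↦ l + s(b)` for `b` in `B^N`, in
degree `n + 2`. -/
def degenEquiv (n : ℕ) : (LGr X (n + 2) × QGr X (n + 1)) ≃ₗ[Env X] DGr X (n + 2) :=
  prodQuotientEquiv (N := NGr X (n + 1)) (j := mulMap X ∘ₗ (LGr X (n + 2)).subtype) (f := s X)
    (disjoint_DGr_NGr _) (DGr_sup_NGr _) (mulMap_injective.comp Subtype.val_injective)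
    (s_injOn_pos.mono (inf_le_right.trans (gr_succ_le_pos n)))
    (by
      rw [LinearMap.range_comp, Submodule.range_subtype]
      exact disjoint_map_mulMap_map_s n)
    (by rw [LinearMap.range_comp, Submodule.range_subtype, map_mulMap_sup_map_s])

lemma degenEquiv_mk {n : ℕ} (l : LGr X (n + 2)) (b : gr X (n + 1)) (hb : (b : B X) ∈ BN X) :
    (degenEquiv X n (l, Submodule.Quotient.mk b) : B X) = mulMap X (l : BL X) + s X (b : B X) :=
  prodQuotientEquiv_mk _ _ _ _ _ _ _ _ ⟨hb, b.2⟩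

end Complement

section BarQuotient

variable {X : Type*} [Shelf X] {M N : Type*} [AddCommGroup M] [AddCommGroup N] [Module (Env X) M]
  [Module (Env X) N]

lemma lact_mem_of_sub_mem {T : AddSubgroup M} (hT : ∀ (x : X) m, lact (gA x) m - m ∈ T)
    (a : StrAlg X) {m : M} (hm : m ∈ T) : lact a m ∈ T := by
  induction a using strAlg_induction with
  | h1 => rwa [lact_one]
  | hx x a ih =>
    rw [lact_mul, ← sub_add_cancel (lact (gA x) (lact a m)) (lact a m)]
    exact add_mem (hT x _) ih
  | hadd a b ha hb => exact add_lact a b m ▸ add_mem ha hb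
  | hneg a ha => exact neg_lact a m ▸ neg_mem ha

lemma mem_of_mem_barSub {T : AddSubgroup M} (hT : ∀ (x : X) m, lact (gA x) m - m ∈ T) {m : M}
    (hm : m ∈ barSub X M) : m ∈ T := by
  suffices h : ∀ c : StrAlg X, ract m c ∈ T from ract_one (X := X) m ▸ h 1
  have ract_zero_mem (c : StrAlg X) : ract (0 : M) c ∈ T := by
    rw [ract, smul_zero]
    exact zero_mem T
  induction hm using Submodule.span_induction with
  | mem _ hm =>
    obtain ⟨x, m, rfl⟩ := hm
    intro c
    have h : ract (lact (gA x) m - m) c = lact (gA x) (ract m c) - ract m c :=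
      (smul_sub (env 1 c) (lact (gA x) m) m).trans
        (congrArg (· - ract m c) (lact_ract _ _ _).symm)
    exact h ▸ hT x (ract m c)
  | zero => exact ract_zero_mem
  | add m m' _ _ hm hm' => exact fun c => ract_add c m m' ▸ add_mem (hm c) (hm' c)
  | smul r m _ hm =>
    intro c
    induction r using env_induction with
    | h0 =>
      rw [zero_smul]
      exact ract_zero_mem c
    | h a c' =>
      rw [env_eq, mul_smul]
      change ract (lact a (ract m c')) c ∈ T
      rw [← lact_ract, ← ract_mul]
      exact lact_mem_of_sub_mem hT a (hm _)
    | hadd r r' h h' =>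
      rw [add_smul, ract_add]
      exact add_mem h h'

lemma IsLeftLinear.apply_mem_barSub {f : M →ₗ[ℤ] N} (hf : IsLeftLinear X f) {m : M}
    (hm : m ∈ barSub X M) : f m ∈ barSub X N := by
  refine mem_of_mem_barSub (T := (barSub X N).toAddSubgroup.comap f.toAddMonoidHom)
    (fun x m => ?_) hm
  refine Submodule.subset_span ⟨x, f m, ?_⟩
  rw [← hf, ← map_sub]
  rfl

lemma IsLeftLinear.injOn_barMap {f : M →ₗ[Env X] N} {r : N →ₗ[ℤ] M} (hr : IsLeftLinear X r)
    {T : Submodule (Env X) M} (h : ∀ m ∈ T, r (f m) = m) :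
    Set.InjOn (barMap f) (T.map (barSub X M).mkQ : Set (Bar X M)) := by
  rintro _ ⟨m, hm, rfl⟩ _ ⟨m', hm', rfl⟩ heq
  have hf : f m - f m' ∈ barSub X N := (Submodule.Quotient.eq _).1 heq
  have h' := hr.apply_mem_barSub hf
  rw [map_sub, h m hm, h m' hm'] at h'
  exact (Submodule.Quotient.eq _).2 h'

lemma IsLeftLinear.barMap_injective {f : M →ₗ[Env X] N} {r : N →ₗ[ℤ] M} (hr : IsLeftLinear X r)
    (h : ∀ m, r (f m) = m) : Function.Injective (barMap f) := by
  have hinj := hr.injOn_barMap (f := f) (T := ⊤) fun m _ => h m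
  rwa [Submodule.map_top, Submodule.range_mkQ, Submodule.top_coe, Set.injOn_univ] at hinj

lemma IsLeftLinear.disjoint_map_mkQ {r : M →ₗ[ℤ] M} (hr : IsLeftLinear X r)
    {S T : Submodule (Env X) M} (hS : ∀ m ∈ S, r m = 0) (hT : ∀ m ∈ T, r m = m) :
    Disjoint (S.map (barSub X M).mkQ) (T.map (barSub X M).mkQ) := by
  refine Submodule.disjoint_def.2 ?_
  rintro _ ⟨m, hm, rfl⟩ ⟨m', hm', heq⟩
  have h := hr.apply_mem_barSub ((Submodule.Quotient.eq _).1 heq)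
  rw [map_sub, hS m hm, hT m' hm', sub_zero] at h
  exact heq.symm.trans ((Submodule.Quotient.mk_eq_zero _).2 h)

end BarQuotient

section BarDecomposition

variable {X : Type*} [Shelf X]

lemma barMap_mulMap_injective : Function.Injective (barMap (mulMap X)) :=
  (isLeftLinear_extend _).barMap_injective extend_lateWord_mulMap

open Classical in
/-- The element `e_{x₁} ⋯ e_{xₙ}` of `B^D` if `x₁ ⋯ xₙ` has two equal neighbours, else `0`. -/
def degenWord (w : List X) : degen X :=
  if hw : HasRepeat w then ⟨eList w, isWordSpan_degen.eList_mem hw⟩ else 0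

lemma barMap_subtype_degen_injective : Function.Injective (barMap (degen X).subtype) := by
  have hr : IsLeftLinear X (extend (degenWord (X := X))) := isLeftLinear_extend _
  refine hr.barMap_injective fun b => Subtype.ext ?_
  refine IsLeftLinear.eq_of_mem_wordSpan (g := LinearMap.id)
    ((isLeftLinear_restrictScalars (degen X).subtype).comp hr) (fun _ _ => rfl) (fun w hw => ?_)
    (isWordSpan_degen.mem_iff.1 b.2)
  rw [LinearMap.comp_apply, extend_eList, degenWord, dif_pos hw]
  rfl

lemma disjoint_DBar_NBar (n : ℕ) : Disjoint (DBar X n) (NBar X n) :=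
  isLeftLinear_projN.disjoint_map_mkQ (fun _ hb => projN_eq_zero hb.1)
    fun _ hb => projN_eq_self hb.1

lemma DBar_sup_NBar (n : ℕ) : DBar X n ⊔ NBar X n = grBar X n := by
  rw [DBar, NBar, grBar, ← Submodule.map_sup, DGr_sup_NGr]

lemma injOn_sBar (n : ℕ) : Set.InjOn (sBar X) (NBar X (n + 1) : Set (BBar X)) :=
  isLeftLinear_unrepeat.injOn_barMap fun _ hb => unrepeat_s hb.1 (gr_succ_le_pos n hb.2)

lemma map_sBar_NBar (n : ℕ) :
    (NBar X n).map (sBar X) = ((NGr X n).map (s X)).map (pr X) := by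
  rw [NBar, ← Submodule.map_comp, ← Submodule.map_comp]
  rfl

lemma disjoint_LBar_map_sBar (n : ℕ) :
    Disjoint (LBar X (n + 2)) ((NBar X (n + 1)).map (sBar X)) := by
  rw [map_sBar_NBar]
  refine IsLeftLinear.disjoint_map_mkQ (r := (s X).restrictScalars ℤ ∘ₗ unrepeat)
    ((isLeftLinear_restrictScalars _).comp isLeftLinear_unrepeat) (fun b hb => ?_) ?_
  · exact (congrArg (s X) (unrepeat_eq_zero (LinearMap.map_le_range hb))).trans (map_zero _)
  · rintro _ ⟨b, hb, rfl⟩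
    exact congrArg (s X) (unrepeat_s hb.1 (gr_succ_le_pos n hb.2))

lemma LBar_sup_map_sBar (n : ℕ) :
    LBar X (n + 2) ⊔ (NBar X (n + 1)).map (sBar X) = DBar X (n + 2) := by
  rw [map_sBar_NBar, LBar, DBar, ← Submodule.map_sup, map_mulMap_sup_map_s]

variable (X) in
/-- The isomorphism `B̄^L_n ⊕ B̄^Q_{n-1} ≃ B̄^D_n`, `(l, [b]) ↦ l + s(b)` for `b` in `B̄^N`, in
degree `n + 2`. -/
def degenBarEquiv (n : ℕ) : (LBar X (n + 2) × QBar X (n + 1)) ≃ₗ[Env X] DBar X (n + 2) :=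
  prodQuotientEquiv (N := NBar X (n + 1)) (j := (LBar X (n + 2)).subtype) (f := sBar X)
    (disjoint_DBar_NBar _) (DBar_sup_NBar _) Subtype.val_injective (injOn_sBar n)
    (by
      rw [Submodule.range_subtype]
      exact disjoint_LBar_map_sBar n)
    (by rw [Submodule.range_subtype, LBar_sup_map_sBar])

lemma degenBarEquiv_mk {n : ℕ} (l : LBar X (n + 2)) (b : grBar X (n + 1))
    (hb : (b : BBar X) ∈ NBar X (n + 1)) :
    (degenBarEquiv X n (l, Submodule.Quotient.mk b) : BBar X) = l + sBar X (b : BBar X) :=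
  prodQuotientEquiv_mk _ _ _ _ _ _ _ _ hb

end BarDecomposition

section BarBasis

variable {X : Type*} [Shelf X]

lemma pr_gx_mul (x : X) (b : B X) : pr X (gx x * b) = pr X b := by
  refine (Submodule.Quotient.eq _).2 (Submodule.subset_span ⟨x, b, ?_⟩)
  rw [lact_B, incl_gA]

lemma pr_monomial (m : StrMonoid X) (w : List X) : pr X (monomial m w) = pr X (eList w) := by
  induction m using strMonoid_induction with
  | one => rw [monomial_one]
  | of_mul x m ih => rw [← gx_mul_monomial, pr_gx_mul, ih]

lemma IsWordSpan.map_pr {S : Submodule (Env X) (B X)} {P : List X → Prop}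
    (hS : IsWordSpan S P) : (S.map (pr X)).restrictScalars ℤ =
      Submodule.span ℤ ((fun w => pr X (eList w)) '' {w | P w}) := by
  have h : (S.map (pr X)).restrictScalars ℤ = (wordSpan P).map ((pr X).restrictScalars ℤ) := by
    rw [← hS]
    rfl
  rw [h, wordSpan, Submodule.map_span]
  congr 1
  ext b
  constructor
  · rintro ⟨_, ⟨p, hp, rfl⟩, rfl⟩
    refine ⟨p.2, hp, ?_⟩
    rw [monomialBasis_apply]
    exact (pr_monomial _ _).symm
  · rintro ⟨w, hw, rfl⟩
    refine ⟨_, ⟨(1, w), hw, rfl⟩, ?_⟩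
    rw [monomialBasis_apply]
    exact pr_monomial _ _

/-- The linear map `B → ℤ⟨X⟩` sending `m e_{x₁} ⋯ e_{xₙ}` to the word `x₁ ⋯ xₙ`. -/
def toWords : B X →ₗ[ℤ] List X →₀ ℤ :=
  (monomialBasis X).constr ℤ fun p => Finsupp.single p.2 1

lemma toWords_monomial (m : StrMonoid X) (w : List X) :
    toWords (monomial m w) = Finsupp.single w 1 := by
  rw [toWords, ← monomialBasis_apply (m, w), Module.Basis.constr_basis]

lemma toWords_gx_mul (x : X) (b : B X) : toWords (gx x * b) = toWords b := by
  have h : toWords ∘ₗ LinearMap.mulLeft ℤ (gx x) = toWords := linearMap_ext fun m w => by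
    rw [LinearMap.comp_apply, LinearMap.mulLeft_apply, gx_mul_monomial, toWords_monomial,
      toWords_monomial]
  exact LinearMap.congr_fun h b

lemma toWords_eq_zero {b : B X} (hb : b ∈ barSub X (B X)) : toWords b = 0 := by
  refine mem_of_mem_barSub (T := toWords.toAddMonoidHom.ker) (fun x b => ?_) hb
  rw [lact_B, incl_gA, AddMonoidHom.mem_ker, LinearMap.toAddMonoidHom_coe, map_sub,
    toWords_gx_mul, sub_self]

lemma linearIndependent_pr_eList :
    LinearIndependent ℤ fun w : List X => pr X (eList w) := by
  let f : BBar X →ₗ[ℤ] List X →₀ ℤ :=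
    ((barSub X (B X)).restrictScalars ℤ).liftQ toWords (fun _ => toWords_eq_zero) ∘ₗ
      (Submodule.Quotient.restrictScalarsEquiv ℤ (barSub X (B X))).symm.toLinearMap
  refine LinearIndependent.of_comp f ?_
  have hf : (f ∘ fun w => pr X (eList w)) = fun w => Finsupp.single w 1 :=
    funext fun w => (congrArg toWords (monomial_one w).symm).trans (toWords_monomial 1 w)
  rw [hf]
  exact Finsupp.linearIndependent_single_one ℤ _

end BarBasis

section Differential

section Shelf

variable {X : Type*} [Shelf X]

lemma BN_le_of_diffWord_mem {T : Submodule (Env X) (B X)} (h : ∀ w, diffWord w ∈ T) :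
    BN X ≤ T := by
  intro b hb
  refine (AddSubgroup.closure_le T.toAddSubgroup).2 ?_ hb
  rintro _ ⟨a, w, rfl⟩
  exact lact_B a (diffWord w) ▸ T.smul_mem (env a 1) (h w)

lemma ge_sub_ge_mul_diffWord_mem_BN (x y : X) (w : List X) :
    (ge x - ge y) * diffWord w ∈ BN X := by
  cases w with
  | nil =>
    rw [diffWord, mul_one]
    exact sub_mem (diffWord_mem_BN [x]) (diffWord_mem_BN [y])
  | cons z w =>
    rw [← sub_sub_sub_cancel_right (ge x) (ge y) (ge z), sub_mul]
    exact sub_mem (diffWord_mem_BN (x :: z :: w)) (diffWord_mem_BN (y :: z :: w))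

lemma ge_sub_ge_mul_mem_BN (x y : X) {b : B X} (hb : b ∈ BN X) : (ge x - ge y) * b ∈ BN X := by
  refine (AddSubgroup.closure_le ((BN X).toAddSubgroup.comap
    (AddMonoidHom.mulLeft (ge x - ge y)))).2 ?_ hb
  rintro _ ⟨a, w, rfl⟩
  change (ge x - ge y) * (incl a * diffWord w) ∈ BN X
  induction a using strAlg_induction generalizing x y with
  | h1 =>
    rw [map_one, one_mul]
    exact ge_sub_ge_mul_diffWord_mem_BN x y w
  | hx z a ih =>
    rw [map_mul, incl_gA, mul_assoc, ← mul_assoc, sub_mul, ← ge_rel, ← ge_rel, ← mul_sub, mul_assoc]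
    exact gx_mul_mem _ z (ih _ _)
  | hadd a a' ha ha' =>
    rw [map_add, add_mul, mul_add]
    exact add_mem (ha x y) (ha' x y)
  | hneg a ha =>
    rw [map_neg, neg_mul, mul_neg]
    exact neg_mem (ha x y)

lemma d_ge_sub_ge_mul (x y : X) (b : B X) :
    d X ((ge x - ge y) * b) = (gx y - gx x) * b - (ge x - ge y) * d X b := by
  rw [sub_mul, map_sub, d_ge_mul, d_ge_mul]
  noncomm_ring

lemma d_mem_BN {b : B X} (hb : b ∈ BN X) : d X b ∈ BN X := by
  refine BN_le_of_diffWord_mem (T := (BN X).comap (d X)) (fun w => ?_) hb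
  rw [Submodule.mem_comap]
  induction w with
  | nil => simp [diffWord]
  | cons x w ih =>
    cases w with
    | nil =>
      rw [diffWord, d_ge, ← mul_one (1 - gx x), sub_mul, one_mul]
      exact sub_mem (diffWord_mem_BN []) (gx_mul_mem _ x (diffWord_mem_BN []))
    | cons y w =>
      have hw := diffWord_mem_BN (y :: w)
      rw [diffWord, d_ge_sub_ge_mul, sub_mul]
      exact sub_mem (sub_mem (gx_mul_mem _ y hw) (gx_mul_mem _ x hw)) (ge_sub_ge_mul_mem_BN x y ih)

lemma dBar_mem_NBar {n : ℕ} {b : BBar X} (hb : b ∈ NBar X (n + 1)) : dBar X b ∈ NBar X n := by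
  obtain ⟨b, hb, rfl⟩ := hb
  exact ⟨d X b, ⟨d_mem_BN hb.1, d_mem_gr hb.2⟩, rfl⟩

lemma dBar_pr (b : B X) : dBar X (pr X b) = pr X (d X b) := rfl

lemma pr_d_ge_mul (x : X) (b : B X) : pr X (d X (ge x * b)) = -pr X (ge x * d X b) := by
  rw [d_ge_mul, sub_mul, one_mul, map_sub, map_sub, pr_gx_mul, sub_self, zero_sub]

lemma dBar_eq_zero_of_mem_grBar_one {b : BBar X} (hb : b ∈ grBar X 1) : dBar X b = 0 := by
  obtain ⟨b, hb, rfl⟩ := hb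
  refine (isWordSpan_gr 1).le_of_eList_mem (T := LinearMap.ker (pr X ∘ₗ d X)) (fun w hw => ?_) hb
  obtain ⟨x, rfl⟩ := List.length_eq_one_iff.1 hw
  rw [LinearMap.mem_ker, LinearMap.comp_apply, eList_cons, pr_d_ge_mul, eList_nil, d_one, mul_zero,
    map_zero, neg_zero]

lemma ge_mul_mem_map_mulMap (x : X) {n : ℕ} {b : B X} (hb : b ∈ DGr X n) :
    ge x * b ∈ (LGr X (n + 1)).map (mulMap X) := by
  rw [map_mulMap_LGr]
  exact ⟨⟨tmulA ⟨ge x, ge_mem_gr_one x⟩ ⟨b, hb.1⟩, rfl⟩, ge_mul_mem_gr x hb.2⟩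

lemma exists_mem_NBar_mk_eq {n : ℕ} (q : QBar X n) :
    ∃ b : grBar X n, (b : BBar X) ∈ NBar X n ∧ Submodule.Quotient.mk b = q := by
  obtain ⟨g, rfl⟩ := Submodule.Quotient.mk_surjective _ q
  obtain ⟨c, hc, b, hb, h⟩ := Submodule.mem_sup.1 ((DBar_sup_NBar n).ge g.2)
  refine ⟨⟨b, (DBar_sup_NBar n).le (Submodule.mem_sup_right hb)⟩, hb, ?_⟩
  refine ((Submodule.Quotient.eq _).2 ?_).symm
  change (g : BBar X) - b ∈ DBar X n
  rwa [← h, add_sub_cancel_right]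

lemma LBar_le_DBar (n : ℕ) : LBar X n ≤ DBar X n := by
  rw [LBar, map_mulMap_LGr]
  exact Submodule.map_mono (inf_le_inf_right _ range_mulMap_le_degen)

lemma DBar_one_eq_bot : DBar X 1 = ⊥ := by
  rw [DBar, DGr_eq_bot one_lt_two, Submodule.map_bot]

end Shelf

variable {X : Type*} [Spindle X]

lemma pr_d_s {b : B X} (hb : b ∈ BN X) : pr X (d X (s X b)) = -pr X (s X (d X b)) := by
  refine IsLeftLinear.eq_of_mem_BN (f := (pr X ∘ₗ d X ∘ₗ s X).restrictScalars ℤ)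
    (g := (-(pr X ∘ₗ s X ∘ₗ d X)).restrictScalars ℤ) (isLeftLinear_restrictScalars _)
    (isLeftLinear_restrictScalars _) (fun w => ?_) hb
  change pr X (d X (s X (diffWord w))) = -pr X (s X (d X (diffWord w)))
  match w with
  | [] => simp [diffWord]
  | [x] =>
    have hd : d X (ge x * (ge x * 1)) = 0 := by rw [d_ge_sq, d_one, mul_zero, mul_zero]
    have hs : s X (ge x) = ge x * (ge x * 1) := by simpa [mul_assoc] using s_ge_mul x 1
    have hgx : s X (gx x) = 0 := by simpa using s_gx_mul x 1
    rw [diffWord, d_ge, hs, hd, map_sub, s_one, hgx, sub_zero, map_zero, neg_zero]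
  | x :: y :: v =>
    generalize hc : diffWord (y :: v) = c
    have hds : d X (s X ((ge x - ge y) * c)) = s X ((ge x - ge y) * d X c) := by
      simp only [sub_mul, map_sub, s_ge_mul, mul_assoc, d_ge_sq]
    have hsd : pr X (s X ((gx y - gx x) * c)) = 0 := by
      rw [sub_mul, map_sub, map_sub, s_gx_mul, s_gx_mul, pr_gx_mul, pr_gx_mul, sub_self]
    rw [diffWord, hc, hds, d_ge_sub_ge_mul, map_sub, map_sub, hsd, zero_sub, neg_neg]

lemma dBar_sBar {n : ℕ} {b : BBar X} (hb : b ∈ NBar X n) :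
    dBar X (sBar X b) = -sBar X (dBar X b) := by
  obtain ⟨b, hb, rfl⟩ := hb
  exact pr_d_s hb.1

lemma map_dBar_map_sBar_le (n : ℕ) :
    ((NBar X (n + 2)).map (sBar X)).map (dBar X) ≤ (NBar X (n + 1)).map (sBar X) := by
  rintro _ ⟨_, ⟨b, hb, rfl⟩, rfl⟩
  rw [dBar_sBar hb, ← map_neg]
  exact Submodule.mem_map_of_mem (neg_mem (dBar_mem_NBar hb))

lemma map_dBar_LBar_le (n : ℕ) : (LBar X (n + 1)).map (dBar X) ≤ LBar X n := by
  rw [LBar, LBar, ← Submodule.map_comp, Submodule.map_le_iff_le_comap, map_mulMap_LGr]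
  refine (isWordSpan_range_mulMap.inf (isWordSpan_gr (n + 1))).le_of_eList_mem fun w ⟨hw, hl⟩ => ?_
  obtain ⟨x, v, rfl, hv⟩ := exists_tail_eq_cons_of_hasRepeat_tail hw
  obtain rfl : v.length = n := by simpa using hl
  obtain ⟨k, hk⟩ := Nat.exists_eq_add_of_le' hv.two_le_length
  have hd : d X (eList v) ∈ DGr X (k + 1) :=
    ⟨d_mem_degen (isWordSpan_degen.eList_mem hv), d_mem_gr ((isWordSpan_gr _).eList_mem hk)⟩
  rw [Submodule.mem_comap, LinearMap.comp_apply, eList_cons, dBar_pr, pr_d_ge_mul, hk]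
  exact neg_mem (Submodule.mem_map_of_mem (ge_mul_mem_map_mulMap x hd))

variable (X) in
/-- The differential `B̄^L_{n+1} → B̄^L_n`. -/
def dLBar (n : ℕ) : LBar X (n + 1) →ₗ[Env X] LBar X n :=
  (dBar X).restrict fun _ hb => map_dBar_LBar_le n (Submodule.mem_map_of_mem hb)

lemma coe_dLBar (n : ℕ) (l : LBar X (n + 1)) : (dLBar X n l : BBar X) = dBar X (l : BBar X) := rfl

lemma dDBar_degenBarEquiv {n : ℕ} (l : LBar X (n + 3)) (q : QBar X (n + 2)) :
    dDBar X (n + 2) (degenBarEquiv X (n + 1) (l, q)) =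
      degenBarEquiv X n (dLBar X (n + 2) l, -dQBar X (n + 1) q) := by
  obtain ⟨b, hb, rfl⟩ := exists_mem_NBar_mk_eq q
  refine Subtype.ext ?_
  change dBar X (degenBarEquiv X (n + 1) (l, Submodule.Quotient.mk b) : BBar X) =
    degenBarEquiv X n (dLBar X (n + 2) l, Submodule.Quotient.mk (-dGrBar X (n + 1) b))
  rw [degenBarEquiv_mk l b hb, degenBarEquiv_mk _ _ (neg_mem (dBar_mem_NBar hb)), map_add,
    dBar_sBar hb, coe_dLBar, Submodule.coe_neg, map_neg]
  rfl

lemma dDBar_one_apply (b : DBar X 2) : dDBar X 1 b = 0 :=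
  Subtype.ext ((Submodule.mem_bot _).1 (DBar_one_eq_bot.le (dDBar X 1 b).2))

lemma dLBar_one_apply (l : LBar X 2) : dLBar X 1 l = 0 :=
  Subtype.ext ((Submodule.mem_bot _).1 (DBar_one_eq_bot.le (LBar_le_DBar 1 (dLBar X 1 l).2)))

lemma dQBar_zero_apply (q : QBar X 1) : dQBar X 0 q = 0 := by
  obtain ⟨b, rfl⟩ := Submodule.Quotient.mk_surjective _ q
  exact congrArg Submodule.Quotient.mk (Subtype.ext (dBar_eq_zero_of_mem_grBar_one b.2))

end Differential

section RackComplex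

section Repeats

variable {X : Type*}

lemma hasRepeat_iff_getElem? {w : List X} :
    HasRepeat w ↔ ∃ (i : ℕ) (y : X), w[i]? = some y ∧ w[i + 1]? = some y := by
  simp only [HasRepeat, List.infix_iff_getElem?]
  constructor
  · rintro ⟨y, i, -, h⟩
    exact ⟨i, y, by simpa using h 0 (by simp), by simpa [add_comm] using h 1 (by simp)⟩
  · rintro ⟨i, y, h₀, h₁⟩
    obtain ⟨hi, -⟩ := List.getElem?_eq_some_iff.1 h₁
    refine ⟨y, i, by simp only [List.length_cons, List.length_nil]; omega, fun k hk => ?_⟩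
    match k, hk with
    | 0, _ => simpa using h₀
    | 1, _ => simpa [add_comm] using h₁

lemma hasRepeat_ofFn {n : ℕ} {x : Fin n → X} :
    HasRepeat (List.ofFn x) ↔ ∃ i j : Fin n, (i : ℕ) + 1 = j ∧ x i = x j := by
  simp only [hasRepeat_iff_getElem?, List.getElem?_ofFn]
  constructor
  · rintro ⟨i, y, h₀, h₁⟩
    obtain ⟨hi, hiy⟩ := Option.dite_none_right_eq_some.1 h₀
    obtain ⟨hj, hjy⟩ := Option.dite_none_right_eq_some.1 h₁
    exact ⟨⟨i, hi⟩, ⟨i + 1, hj⟩, rfl, Option.some.inj (hiy.trans hjy.symm)⟩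
  · rintro ⟨i, j, hij, h⟩
    refine ⟨i, x i, dif_pos i.2, ?_⟩
    simp only [hij, j.2, dif_pos, h]

lemma hasRepeat_tail_ofFn {n : ℕ} {x : Fin n → X} :
    HasRepeat (List.ofFn x).tail ↔
      ∃ i j : Fin n, 0 < (i : ℕ) ∧ (i : ℕ) + 1 = j ∧ x i = x j := by
  cases n with
  | zero => simpa using fun h : HasRepeat ([] : List X) => absurd h.two_le_length (by simp)
  | succ n => simp [List.ofFn_succ, hasRepeat_ofFn, Fin.exists_fin_succ]

end Repeats

variable {X : Type*} [Shelf X]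

lemma eMono_eq_eList {n : ℕ} (x : Fin n → X) : eMono x = eList (List.ofFn x) := by
  rw [eMono, eList, List.map_ofFn]
  rfl

lemma eMono_succ {n : ℕ} (x : Fin (n + 1) → X) : eMono x = ge (x 0) * eMono (Fin.tail x) := by
  rw [eMono_eq_eList, eMono_eq_eList, List.ofFn_succ, eList_cons]
  rfl

lemma face1_zero {n : ℕ} (x : Fin (n + 1) → X) : face1 x 0 = Fin.tail x := by
  funext i
  simp [face1, Fin.tail]

lemma eMono_face0_succ {n : ℕ} (x : Fin (n + 2) → X) (i : Fin (n + 1)) :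
    eMono (face0 x i.succ) = ge (x 0) * eMono (face0 (Fin.tail x) i) := by
  rw [eMono_succ]
  congr 2
  funext j
  simp only [face0, Fin.tail, Fin.succ_succAbove_succ]

lemma gx_mul_eMono_face1_succ {n : ℕ} (x : Fin (n + 2) → X) (i : Fin (n + 1)) :
    gx (x i.succ) * eMono (face1 x i.succ) =
      ge (x 0) * (gx (x i.succ) * eMono (face1 (Fin.tail x) i)) := by
  have h₀ : face1 x i.succ 0 = rop (x 0) (x i.succ) := by simp [face1]
  have h : Fin.tail (face1 x i.succ) = face1 (Fin.tail x) i := by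
    funext j
    simp only [face1, Fin.tail, Fin.succ_succAbove_succ, ← Fin.succ_castSucc, Fin.succ_lt_succ_iff]
  rw [eMono_succ, h₀, h, ← mul_assoc, ge_rel, mul_assoc]

lemma d_eMono {n : ℕ} (x : Fin (n + 1) → X) :
    d X (eMono x) = ∑ i : Fin (n + 1), (-1 : ℤ) ^ (i : ℕ) •
      (eMono (face0 x i) - gx (x i) * eMono (face1 x i)) := by
  have hface0 : face0 x 0 = Fin.tail x := rfl
  rw [eMono_succ, d_ge_mul, Fin.sum_univ_succ, hface0, face1_zero, Fin.val_zero, pow_zero,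
    one_smul, sub_mul, one_mul, sub_eq_add_neg]
  congr 1
  cases n with
  | zero => simp [eMono]
  | succ n =>
    rw [d_eMono (Fin.tail x), Finset.mul_sum, ← Finset.sum_neg_distrib]
    refine Finset.sum_congr rfl fun i _ => ?_
    rw [eMono_face0_succ, gx_mul_eMono_face1_succ, ← mul_sub, Fin.val_succ, pow_succ, mul_neg_one,
      neg_smul, mul_smul_comm]
    rfl

variable (X) in
/-- The map `C_n → B̄`, `x₁ ⋯ xₙ ↦ [e_{x₁} ⋯ e_{xₙ}]`. -/
def rackMap (n : ℕ) : RC X n →ₗ[ℤ] BBar X :=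
  Finsupp.linearCombination ℤ fun x => pr X (eMono x)

lemma rackMap_single {n : ℕ} (x : Fin n → X) :
    rackMap X n (Finsupp.single x 1) = pr X (eMono x) := by
  rw [rackMap, Finsupp.linearCombination_single, one_smul]

lemma rackMap_injective (n : ℕ) : Function.Injective (rackMap X n) := by
  have h : LinearIndependent ℤ fun x : Fin n → X => pr X (eList (List.ofFn x)) :=
    linearIndependent_pr_eList.comp _ List.ofFn_injective
  simp only [← eMono_eq_eList] at h
  exact h

lemma rackMap_bdry {n : ℕ} (c : RC X (n + 1)) :
    rackMap X n (bdry X n c) = dBar X (rackMap X (n + 1) c) := by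
  suffices h : rackMap X n ∘ₗ bdry X n = (dBar X).restrictScalars ℤ ∘ₗ rackMap X (n + 1) from
    LinearMap.congr_fun h c
  refine Finsupp.lhom_ext' fun x => LinearMap.ext_ring ?_
  change rackMap X n (bdry X n (Finsupp.single x 1)) =
    dBar X (rackMap X (n + 1) (Finsupp.single x 1))
  rw [rackMap_single, dBar_pr, d_eMono, bdry, Finsupp.linearCombination_single, one_smul, map_sum,
    map_sum]
  refine Finset.sum_congr rfl fun i _ => ?_
  rw [map_zsmul, map_zsmul, map_sub, map_sub, rackMap_single, rackMap_single, pr_gx_mul]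

lemma map_rackMap_span {n : ℕ} {S : Submodule (Env X) (B X)} {P : List X → Prop}
    (hS : IsWordSpan S fun w => P w ∧ w.length = n) :
    (Submodule.span ℤ {c : RC X n | ∃ x, P (List.ofFn x) ∧ c = Finsupp.single x 1}).map
      (rackMap X n) = (S.map (pr X)).restrictScalars ℤ := by
  rw [hS.map_pr, Submodule.map_span]
  congr 1
  ext b
  constructor
  · rintro ⟨_, ⟨x, hx, rfl⟩, rfl⟩
    exact ⟨List.ofFn x, ⟨hx, List.length_ofFn⟩, by rw [rackMap_single, eMono_eq_eList]⟩
  · rintro ⟨w, ⟨hw, rfl⟩, rfl⟩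
    refine ⟨_, ⟨w.get, by rwa [List.ofFn_get], rfl⟩, ?_⟩
    rw [rackMap_single, eMono_eq_eList, List.ofFn_get]

lemma range_rackMap (n : ℕ) :
    LinearMap.range (rackMap X n) = (grBar X n).restrictScalars ℤ := by
  have hS : IsWordSpan (gr X n) fun w => True ∧ w.length = n := by
    simpa only [true_and] using isWordSpan_gr n
  rw [grBar, ← map_rackMap_span hS, LinearMap.range_eq_map,
    ← (Finsupp.basisSingleOne (R := ℤ) (ι := Fin n → X)).span_eq]
  congr 2
  ext c
  simp [eq_comm]

lemma map_rackMap_CD (n : ℕ) : (CD X n).map (rackMap X n) = (DBar X n).restrictScalars ℤ := by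
  rw [DBar, ← map_rackMap_span (isWordSpan_DGr n)]
  simp only [hasRepeat_ofFn]
  rfl

lemma map_rackMap_CL (n : ℕ) : (CL X n).map (rackMap X n) = (LBar X n).restrictScalars ℤ := by
  rw [LBar, map_mulMap_LGr, ← map_rackMap_span (isWordSpan_range_mulMap.inf (isWordSpan_gr n))]
  simp only [hasRepeat_tail_ofFn]
  rfl

lemma mem_CD_iff {n : ℕ} {c : RC X n} : c ∈ CD X n ↔ rackMap X n c ∈ DBar X n := by
  rw [← Submodule.restrictScalars_mem ℤ (DBar X n), ← map_rackMap_CD]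
  exact ((rackMap_injective n).mem_set_image (s := (CD X n : Set (RC X n)))).symm

lemma mem_CL_iff {n : ℕ} {c : RC X n} : c ∈ CL X n ↔ rackMap X n c ∈ LBar X n := by
  rw [← Submodule.restrictScalars_mem ℤ (LBar X n), ← map_rackMap_CL]
  exact ((rackMap_injective n).mem_set_image (s := (CL X n : Set (RC X n)))).symm

end RackComplex

section RackEquivalences

section RestrictScalars

variable {R S C V : Type*} [Semiring R] [Semiring S] [AddCommMonoid C] [Module R C]
  [AddCommMonoid V] [Module R V] [Module S V] [SMul R S] [IsScalarTower R S V] {P : Submodule R C}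
  {Q : Submodule S V} {f : C →ₗ[R] V}

/-- The isomorphism onto its image induced by an injective `R`-linear map, where the image is an
`S`-submodule. -/
def equivOfMapEqRestrictScalars (hf : Function.Injective f)
    (h : P.map f = Q.restrictScalars R) : P ≃ₗ[R] Q :=
  (Submodule.equivMapOfInjective f hf P).trans (LinearEquiv.ofEq _ _ h)

end RestrictScalars

section Shelf

variable {X : Type*} [Shelf X]

variable (X) in
/-- The isomorphism `C_n ≃ B̄_n`. -/
def rackEquiv (n : ℕ) : RC X n ≃ₗ[ℤ] grBar X n :=
  Submodule.topEquiv.symm.trans <|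
    equivOfMapEqRestrictScalars (P := ⊤) (Q := grBar X n) (rackMap_injective n)
      (by rw [Submodule.map_top, range_rackMap])

lemma rackEquiv_bdry {n : ℕ} (c : RC X (n + 1)) :
    rackEquiv X n (bdry X n c) = dGrBar X n (rackEquiv X (n + 1) c) :=
  Subtype.ext (rackMap_bdry c)

variable (X) in
/-- The isomorphism `C^D_n ≃ B̄^D_n`. -/
def rackDegenEquiv (n : ℕ) : CD X n ≃ₗ[ℤ] DBar X n :=
  equivOfMapEqRestrictScalars (rackMap_injective n) (map_rackMap_CD n)

variable (X) in
/-- The isomorphism `C^L_n ≃ B̄^L_n`. -/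
def rackLateEquiv (n : ℕ) : CL X n ≃ₗ[ℤ] LBar X n :=
  equivOfMapEqRestrictScalars (rackMap_injective n) (map_rackMap_CL n)

lemma coe_rackLateEquiv {n : ℕ} (c : CL X n) :
    (rackLateEquiv X n c : BBar X) = rackMap X n c := rfl

variable (X) in
/-- The isomorphism `C^Q_n ≃ B̄^Q_n`. -/
def rackQuotientEquiv (n : ℕ) : CQ X n ≃ₗ[ℤ] QBar X n :=
  Submodule.Quotient.equiv (CD X n) (((DBar X n).submoduleOf (grBar X n)).restrictScalars ℤ)
    (rackEquiv X n) (by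
      ext b
      obtain ⟨c, rfl⟩ := (rackEquiv X n).surjective b
      exact ((rackEquiv X n).injective.mem_set_image (s := (CD X n : Set (RC X n)))).trans
        mem_CD_iff) |>.trans (Submodule.Quotient.restrictScalarsEquiv ℤ _)

lemma rackQuotientEquiv_mk {n : ℕ} (c : RC X n) :
    rackQuotientEquiv X n (Submodule.Quotient.mk c) =
      Submodule.Quotient.mk (rackEquiv X n c) := rfl

variable (X) in
/-- The Litherland–Nelson isomorphism `C^L_n ⊕ C^Q_{n-1} ≃ C^D_n`, for `n ≥ 2`. -/
def litherlandNelsonEquiv (n : ℕ) : (CL X (n + 2) × CQ X (n + 1)) ≃ₗ[ℤ] CD X (n + 2) :=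
  ((rackLateEquiv X (n + 2)).prodCongr (rackQuotientEquiv X (n + 1))).trans
    (((degenBarEquiv X n).restrictScalars ℤ).trans (rackDegenEquiv X (n + 2)).symm)

lemma rackMap_litherlandNelsonEquiv {n : ℕ} (l : CL X (n + 2)) (q : CQ X (n + 1)) :
    rackMap X (n + 2) (litherlandNelsonEquiv X n (l, q)) =
      degenBarEquiv X n (rackLateEquiv X (n + 2) l, rackQuotientEquiv X (n + 1) q) :=
  congrArg Subtype.val ((rackDegenEquiv X (n + 2)).apply_symm_apply _)

end Shelf

variable {X : Type*} [Spindle X]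

lemma map_bdry_CD_le (n : ℕ) : (CD X (n + 1)).map (bdry X n) ≤ CD X n := by
  rintro _ ⟨c, hc, rfl⟩
  rw [mem_CD_iff, rackMap_bdry]
  exact dBar_DBar n _ (mem_CD_iff.1 hc)

lemma map_bdry_CL_le (n : ℕ) : (CL X (n + 1)).map (bdry X n) ≤ CL X n := by
  rintro _ ⟨c, hc, rfl⟩
  rw [mem_CL_iff, rackMap_bdry]
  exact map_dBar_LBar_le n (Submodule.mem_map_of_mem (mem_CL_iff.1 hc))

lemma bdry_litherlandNelsonEquiv {n : ℕ} {l : CL X (n + 3)} {l' : CL X (n + 2)}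
    (hl : (l' : RC X (n + 2)) = bdry X (n + 2) l) (c : RC X (n + 2)) :
    bdry X (n + 2) (litherlandNelsonEquiv X (n + 1) (l, Submodule.Quotient.mk c)) =
      litherlandNelsonEquiv X n (l', -Submodule.Quotient.mk (bdry X (n + 1) c)) := by
  have hlate : rackLateEquiv X (n + 2) l' = dLBar X (n + 2) (rackLateEquiv X (n + 3) l) := by
    refine Subtype.ext ?_
    rw [coe_dLBar, coe_rackLateEquiv, coe_rackLateEquiv, hl, rackMap_bdry]
  have hquot : rackQuotientEquiv X (n + 1) (-Submodule.Quotient.mk (bdry X (n + 1) c)) =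
      -dQBar X (n + 1) (rackQuotientEquiv X (n + 2) (Submodule.Quotient.mk c)) := by
    rw [map_neg, rackQuotientEquiv_mk, rackQuotientEquiv_mk, rackEquiv_bdry]
    rfl
  refine rackMap_injective _ ?_
  rw [rackMap_bdry, rackMap_litherlandNelsonEquiv, rackMap_litherlandNelsonEquiv, hlate, hquot,
    ← dDBar_degenBarEquiv]
  rfl

lemma bdry_one_of_mem_CD {c : RC X 2} (hc : c ∈ CD X 2) : bdry X 1 c = 0 := by
  refine rackMap_injective 1 ?_
  rw [map_zero, ← Submodule.mem_bot (Env X), ← DBar_one_eq_bot, ← mem_CD_iff]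
  exact map_bdry_CD_le 1 (Submodule.mem_map_of_mem hc)

end RackEquivalences

end ShelfBialg

end

theorem mainTheorem7 (X : Type*) [Spindle X] :
    -- the degeneracy `s` is an injective map `B⁺ → B^D` of degree `1`
    ((∀ n, ∀ b ∈ gr X (n + 1), s X b ∈ DGr X (n + 2)) ∧
      (∀ b ∈ pos X, s X b ∈ degen X) ∧
      Set.InjOn (s X) (pos X : Set (B X))) ∧
    -- multiplication identifies `B^L` with the graded sub-bimodule `B⁺ B^D` of `B^D`
    (Function.Injective (mulMap X) ∧
      LinearMap.range (mulMap X) =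
        Submodule.span (Env X) {t | ∃ b ∈ pos X, ∃ c ∈ degen X, t = b * c} ∧
      LinearMap.range (mulMap X) ≤ degen X ∧
      (∀ n, (LGr X n).map (mulMap X) = LinearMap.range (mulMap X) ⊓ gr X n)) ∧
    -- the internal decomposition `B^D = B^L ⊕ s((B^N)⁺)`, globally and in each degree
    (Disjoint (LinearMap.range (mulMap X)) ((BN X ⊓ pos X).map (s X)) ∧
      LinearMap.range (mulMap X) ⊔ (BN X ⊓ pos X).map (s X) = degen X ∧
      DGr X 0 = ⊥ ∧ DGr X 1 = ⊥ ∧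
      (∀ n, Disjoint ((LGr X (n + 2)).map (mulMap X)) ((NGr X (n + 1)).map (s X)) ∧
        (LGr X (n + 2)).map (mulMap X) ⊔ (NGr X (n + 1)).map (s X) = DGr X (n + 2))) ∧
    -- `B^D_n ≃ B^L_n ⊕ B^Q_{n-1}` as bimodules for `n ≥ 2`
    (∃ Φ : ∀ n : ℕ, (LGr X (n + 2) × QGr X (n + 1)) ≃ₗ[Env X] DGr X (n + 2),
      ∀ (n : ℕ) (l : LGr X (n + 2)) (b : gr X (n + 1)), (b : B X) ∈ BN X →
        ((Φ n (l, Submodule.Quotient.mk b) : DGr X (n + 2)) : B X) =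
          mulMap X (l : BL X) + s X (b : B X)) ∧
    -- in `B̄`: the functor `M ↦ M̄` applied to `B^L → B` and `B^D → B` gives injections,
    -- and `B̄^L` and `s((B̄^N)⁺)` are stable under the differential
    (Function.Injective (barMap (mulMap X)) ∧
      Function.Injective (barMap (degen X).subtype) ∧
      (∀ n, (LBar X (n + 1)).map (dBar X) ≤ LBar X n) ∧
      (∀ n, ((NBar X (n + 2)).map (sBar X)).map (dBar X) ≤ (NBar X (n + 1)).map (sBar X)) ∧
      (∀ n, Disjoint (LBar X (n + 2)) ((NBar X (n + 1)).map (sBar X)) ∧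
        LBar X (n + 2) ⊔ (NBar X (n + 1)).map (sBar X) = DBar X (n + 2))) ∧
    -- `B̄^D_n ≃ B̄^L_n ⊕ B̄^Q_{n-1}` as d.g. bimodules for `n ≥ 2`
    (∃ (Φ : ∀ n : ℕ, (LBar X (n + 2) × QBar X (n + 1)) ≃ₗ[Env X] DBar X (n + 2))
      (dL : ∀ n : ℕ, LBar X (n + 1) →ₗ[Env X] LBar X n),
      (∀ (n : ℕ) (l : LBar X (n + 2)) (b : grBar X (n + 1)), (b : BBar X) ∈ NBar X (n + 1) →
        ((Φ n (l, Submodule.Quotient.mk b) : DBar X (n + 2)) : BBar X) =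
          (l : BBar X) + sBar X (b : BBar X)) ∧
      (∀ (n : ℕ) (l : LBar X (n + 1)), ((dL n l : LBar X n) : BBar X) = dBar X (l : BBar X)) ∧
      (∀ (n : ℕ) (l : LBar X (n + 3)) (q : QBar X (n + 2)),
        dDBar X (n + 2) (Φ (n + 1) (l, q)) = Φ n (dL (n + 2) l, -dQBar X (n + 1) q)) ∧
      (∀ p, dDBar X 1 (Φ 0 p) = 0) ∧
      (∀ l, dL 1 l = 0) ∧
      (∀ q, dQBar X 0 q = 0) ∧
      -- the rack complex is `B̄`, and the decomposition becomes that of its degenerate part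
      (∃ θ : ∀ n : ℕ, RC X n ≃+ grBar X n,
        (∀ (n : ℕ) (x : Fin n → X),
          ((θ n (Finsupp.single x 1) : grBar X n) : BBar X) = pr X (eMono x)) ∧
        (∀ (n : ℕ) (c : RC X (n + 1)), θ n (bdry X n c) = dGrBar X n (θ (n + 1) c)) ∧
        (∀ (n : ℕ) (c : RC X n), c ∈ CD X n ↔ (θ n c : BBar X) ∈ DBar X n) ∧
        (∀ (n : ℕ) (c : RC X n), c ∈ CL X n ↔ (θ n c : BBar X) ∈ LBar X n) ∧
        (∀ n : ℕ, (CD X (n + 1)).map (bdry X n) ≤ CD X n) ∧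
        (∀ n : ℕ, (CL X (n + 1)).map (bdry X n) ≤ CL X n) ∧
        (∃ Ψ : ∀ n : ℕ, (CL X (n + 2) × CQ X (n + 1)) ≃ₗ[ℤ] CD X (n + 2),
          (∀ (n : ℕ) (l : CL X (n + 2)) (c : RC X (n + 1)) (l' : LBar X (n + 2)),
            (l' : BBar X) = θ (n + 2) (l : RC X (n + 2)) →
            ((θ (n + 2) (Ψ n (l, Submodule.Quotient.mk c) : CD X (n + 2)) : grBar X (n + 2)) :
              BBar X) = (Φ n (l', Submodule.Quotient.mk (θ (n + 1) c)) : DBar X (n + 2))) ∧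
          (∀ (n : ℕ) (l : CL X (n + 3)) (c : RC X (n + 2)) (l' : CL X (n + 2)),
            (l' : RC X (n + 2)) = bdry X (n + 2) (l : RC X (n + 3)) →
            bdry X (n + 2) (Ψ (n + 1) (l, Submodule.Quotient.mk c) : CD X (n + 3)) =
              (Ψ n (l', -Submodule.Quotient.mk (bdry X (n + 1) c)) : CD X (n + 2))) ∧
          (∀ p, bdry X 1 (Ψ 0 p : CD X 2) = 0)))) := by
  refine ⟨⟨s_mem_DGr, s_mem_degen, s_injOn_pos⟩,
    ⟨mulMap_injective, range_mulMap_eq_span, range_mulMap_le_degen, map_mulMap_LGr⟩,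
    ⟨disjoint_range_mulMap_map_s, range_mulMap_sup_map_s, DGr_eq_bot two_pos,
      DGr_eq_bot one_lt_two, fun n => ⟨disjoint_map_mulMap_map_s n, map_mulMap_sup_map_s n⟩⟩,
    ⟨degenEquiv X, fun _ => degenEquiv_mk⟩,
    ⟨barMap_mulMap_injective, barMap_subtype_degen_injective, map_dBar_LBar_le,
      map_dBar_map_sBar_le, fun n => ⟨disjoint_LBar_map_sBar n, LBar_sup_map_sBar n⟩⟩,
    degenBarEquiv X, dLBar X, fun _ => degenBarEquiv_mk, coe_dLBar,
    fun _ => dDBar_degenBarEquiv, fun _ => dDBar_one_apply _, dLBar_one_apply, dQBar_zero_apply,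
    fun n => (rackEquiv X n).toAddEquiv, fun _ => rackMap_single, fun _ => rackEquiv_bdry,
    fun _ _ => mem_CD_iff, fun _ _ => mem_CL_iff, map_bdry_CD_le, map_bdry_CL_le,
    litherlandNelsonEquiv X, fun n l c l' hl => ?_,
    fun _ _ c _ hl => bdry_litherlandNelsonEquiv hl c,
    fun p => bdry_one_of_mem_CD (litherlandNelsonEquiv X 0 p).2⟩
  obtain rfl : rackLateEquiv X (n + 2) l = l' := Subtype.ext hl.symm
  exact rackMap_litherlandNelsonEquiv l (Submodule.Quotient.mk c)
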